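/- For real numbers $\kappa,\tau$, let $\mathbb{E}(\kappa,\tau)$ be the simply connected homogeneous 3-manifold that fibres over the simply connected surface $M^2(\kappa)$ of constant curvature $\kappa$ with bundle curvature $\tau$ and unit vertical Killing field $\xi$; in particular, for $\epsilon\in\{-1,1\}$, $\mathbb{E}(\epsilon,0)=M^2(\epsilon)\times\mathbb{R}$, with $M^2(1)=\mathbb{S}^2$ and $M^2(-1)=\mathbb{H}^2$. A geodesic is horizontal if its velocity is orthogonal to $\xi$, and vertical if its velocity is collinear with $\xi$. A vertical plane of $M^2(\epsilon)\times\mathbb{R}$ is the product of a complete geodesic of $M^2(\epsilon)$ with $\mathbb{R}$, and a horizontal plane (slice) is a set $M^2(\epsilon)\times\{z_0\}$, $z_0\in\mathbb{R}$. Let $\epsilon\in\{-1,1\}$ and $H\ge 0$, let $\Sigma$ be a simply connected Riemannian surface, let $J$ be the rotation of angle $\pi/2$ in its tangent planes (for an orientation of $\Sigma$), let $\phi:\Sigma\to\mathbb{E}(4H^2+\epsilon,H)$ be an isometric minimal immersion, and let $\phi^*:\Sigma\to M^2(\epsilon)\times\mathbb{R}$ be a sister immersion with phase angle $\pi/2$,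 that is, an isometric immersion of constant mean curvature $H$ (half the trace of the shape operator) such that, for unit normal fields $N$ of $\phi$ and $N^*$ of $\phi^*$, $$\nu^*=\nu,\qquad T^*=JT,\qquad S^*=JS+H\,\mathrm{id},$$ where $\nu=\langle N,\xi\rangle$ is the angle function, $T=\xi-\nu N$ the tangent part of the vertical field and $S=-\nabla N$ the shape operator of $\phi$, and $\nu^*,T^*,S^*$ are the corresponding data of $\phi^*$. Let $\alpha:[a,b]\to\Sigma$, $a<b$, be a smooth curve. (a) If $\phi\circ\alpha$ is a regular parametrization of a horizontal geodesic, then $\phi^*\circ\alpha$ is contained in a vertical plane, which the immersion $\phi^*$ meets orthogonally at every point of $\alpha$. (b) If $\phi\circ\alpha$ is a regular parametrization of a vertical geodesic, then $\phi^*\circ\alpha$ is contained in a horizontal plane, which the immersion $\phi^*$ meets orthogonally at every point of $\alpha$. -/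

import Mathlib

open scoped Manifold ContDiff
open Set

noncomputable section

namespace SisterSurface

/-! ### Riemannian submanifolds of a vector space given by explicit formulas -/

/-- A submanifold of the vector space `V` (`carrier`), with its tangent spaces (`tangent x` is the
tangent space at `x ∈ carrier`) and a Riemannian metric. The formula `metric x u v` makes sense for
`x` in a neighbourhood of `carrier` in `V`; only its restriction to tangent vectors matters. -/
structure MetricModel (V : Type) [NormedAddCommGroup V] [NormedSpace ℝ V] where
  carrier : Set V
  tangent : V → Submodule ℝ V
  metric : V → V → V → ℝ

/-- A model with a distinguished (vertical) vector field `xi`. -/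
structure FiberedModel (V : Type) [NormedAddCommGroup V] [NormedSpace ℝ V] extends
    MetricModel V where
  xi : V → V

section Connection

variable {V : Type} [NormedAddCommGroup V] [NormedSpace ℝ V]

/-- The Christoffel symbols of the first kind of the metric, for the constant fields `u`, `v`, `w`:
`Γ(u, v; w) = (D_u g(v, w) + D_v g(u, w) - D_w g(u, v)) / 2`. -/
def MetricModel.christoffel (M : MetricModel V) (x u v w : V) : ℝ :=
  (fderiv ℝ (fun y => M.metric y v w) x u + fderiv ℝ (fun y => M.metric y u w) x v
    - fderiv ℝ (fun y => M.metric y u v) x w) / 2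

/-- `⟨∇_u W, z⟩` for the Levi-Civita connection of the submanifold, where `W` is a tangent field
along a map with value `w` and (ordinary) derivative `dw` in the direction `u` at a point with
image `x`, and `z` is tangent at `x`. By the Koszul formula it is `g(dw, z) + Γ(u, w; z)`. -/
def MetricModel.covDeriv (M : MetricModel V) (x u w dw z : V) : ℝ :=
  M.metric x dw z + M.christoffel x u w z

/-- `⟨∇_{γ'} γ', z⟩` at time `t`, for a curve `γ` defined on the interval `I`. -/
def MetricModel.acceleration (M : MetricModel V) (γ : ℝ → V) (I : Set ℝ) (t : ℝ) (z : V) : ℝ :=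
  M.covDeriv (γ t) (derivWithin γ I t) (derivWithin γ I t)
    (derivWithin (fun s => derivWithin γ I s) I t) z

/-- `γ : I → M` is a (nonconstant, affinely parametrized) geodesic. -/
structure MetricModel.IsGeodesicOn (M : MetricModel V) (γ : ℝ → V) (I : Set ℝ) : Prop where
  smooth : ContDiffOn ℝ ∞ γ I
  mem : ∀ t ∈ I, γ t ∈ M.carrier
  ne_zero : ∀ t ∈ I, derivWithin γ I t ≠ 0
  acceleration_eq : ∀ t ∈ I, ∀ z ∈ M.tangent (γ t), M.acceleration γ I t z = 0

/-- `γ : I → M` is a regular curve that is a geodesic up to reparametrization, that is, whose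
acceleration is everywhere proportional to its velocity. -/
structure MetricModel.IsUnparamGeodesicOn (M : MetricModel V) (γ : ℝ → V) (I : Set ℝ) :
    Prop where
  smooth : ContDiffOn ℝ ∞ γ I
  mem : ∀ t ∈ I, γ t ∈ M.carrier
  ne_zero : ∀ t ∈ I, derivWithin γ I t ≠ 0
  acceleration_eq : ∀ t ∈ I, ∀ z ∈ M.tangent (γ t),
    M.metric (γ t) (derivWithin γ I t) z = 0 → M.acceleration γ I t z = 0

/-- A geodesic (up to reparametrization) whose velocity is orthogonal to `xi`. -/
def FiberedModel.IsHorizontalGeodesicOn (M : FiberedModel V) (γ : ℝ → V) (I : Set ℝ) : Prop :=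
  M.IsUnparamGeodesicOn γ I ∧ ∀ t ∈ I, M.metric (γ t) (derivWithin γ I t) (M.xi (γ t)) = 0

/-- A geodesic (up to reparametrization) whose velocity is collinear with `xi`. -/
def FiberedModel.IsVerticalGeodesicOn (M : FiberedModel V) (γ : ℝ → V) (I : Set ℝ) : Prop :=
  M.IsUnparamGeodesicOn γ I ∧ ∀ t ∈ I, ∃ r : ℝ, derivWithin γ I t = r • M.xi (γ t)

end Connection

/-! ### The homogeneous spaces -/

/-- The simply connected surface `M²(κ)` of constant curvature `κ ≠ 0`: the sphere
`x₀² + x₁² + x₂² = 1/κ` of Euclidean space if `κ > 0`, the upper sheet of the hyperboloid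
`x₀² + x₁² - x₂² = 1/κ` of Minkowski space if `κ < 0`. -/
def surfaceModel (κ : ℝ) : MetricModel (Fin 3 → ℝ) where
  carrier := {x | κ * (x 0 ^ 2 + x 1 ^ 2 + κ.sign * x 2 ^ 2) = 1 ∧ (κ < 0 → 0 < x 2)}
  tangent x :=
    { carrier := {v | x 0 * v 0 + x 1 * v 1 + κ.sign * (x 2 * v 2) = 0}
      add_mem' := by
        intro u v hu hv
        simp only [mem_ofPred_eq, Pi.add_apply] at *
        linear_combination hu + hv
      zero_mem' := by simp
      smul_mem' := by
        intro c v hv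
        simp only [mem_ofPred_eq, Pi.smul_apply, smul_eq_mul] at *
        linear_combination c * hv }
  metric _ u v := u 0 * v 0 + u 1 * v 1 + κ.sign * (u 2 * v 2)

/-- The projection `ℝ³ × ℝ → ℝ³` onto the first three coordinates. -/
def base : (Fin 4 → ℝ) →ₗ[ℝ] (Fin 3 → ℝ) where
  toFun x := ![x 0, x 1, x 2]
  map_add' x y := by ext i; fin_cases i <;> simp
  map_smul' c x := by ext i; fin_cases i <;> simp

/-- The Riemannian product `M²(κ) × ℝ`, for `κ ≠ 0`; the last coordinate is the height. -/
def productSpace (κ : ℝ) : FiberedModel (Fin 4 → ℝ) where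
  carrier := {x | base x ∈ (surfaceModel κ).carrier}
  tangent x := ((surfaceModel κ).tangent (base x)).comap base
  metric x u v := (surfaceModel κ).metric (base x) (base u) (base v) + u 3 * v 3
  xi _ := ![0, 0, 0, 1]

/-- The field `(iz, iw)` on `ℂ² = ℝ⁴`, with `z = x₀ + i x₁` and `w = x₂ + i x₃`. -/
def hopfField (x : Fin 4 → ℝ) : Fin 4 → ℝ := ![-x 1, x 0, -x 3, x 2]

/-- The Berger sphere `𝕊³_b(κ, τ)`, for `κ > 0` and `τ ≠ 0`: the unit sphere of `ℂ²` with the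
metric `(4/κ) (⟨u, v⟩ + (4τ²/κ - 1) ⟨u, V⟩⟨v, V⟩)`, where `V = (iz, iw)`, and `ξ = κ/(4τ) V`. -/
def bergerSphere (κ τ : ℝ) : FiberedModel (Fin 4 → ℝ) where
  carrier := {x | x ⬝ᵥ x = 1}
  tangent x :=
    { carrier := {v | x ⬝ᵥ v = 0}
      add_mem' := by
        intro u v hu hv
        simp only [mem_ofPred_eq, dotProduct_add] at *
        rw [hu, hv, add_zero]
      zero_mem' := by simp
      smul_mem' := by
        intro c v hv
        simp only [mem_ofPred_eq, dotProduct_smul] at *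
        rw [hv, smul_zero] }
  metric x u v :=
    4 / κ * (u ⬝ᵥ v + (4 * τ ^ 2 / κ - 1) * (u ⬝ᵥ hopfField x) * (v ⬝ᵥ hopfField x))
  xi x := (κ / (4 * τ)) • hopfField x

/-- The conformal factor `λ = 1 / (1 + (κ/4)(x₀² + x₁²))`. -/
def conformalFactor (κ : ℝ) (x : Fin 4 → ℝ) : ℝ := 1 / (1 + κ / 4 * (x 0 ^ 2 + x 1 ^ 2))

/-- For `κ ≤ 0`, the space `D × ℝ`, with `D = {1 + (κ/4)(x₀² + x₁²) > 0} ⊆ ℝ²`, with the metric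
`λ² (dx₀² + dx₁²) + (dx₃ + τ λ (x₁ dx₀ - x₀ dx₁))²` and `ξ = ∂/∂x₃`. The coordinate `x₂`
is not used: the space lies in the hyperplane `x₂ = 0`. -/
def cartanSpace (κ τ : ℝ) : FiberedModel (Fin 4 → ℝ) where
  carrier := {x | x 2 = 0 ∧ 0 < 1 + κ / 4 * (x 0 ^ 2 + x 1 ^ 2)}
  tangent _ :=
    { carrier := {v | v 2 = 0}
      add_mem' := by
        intro u v hu hv
        simp only [mem_ofPred_eq, Pi.add_apply] at *
        rw [hu, hv, add_zero]
      zero_mem' := by simp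
      smul_mem' := by
        intro c v hv
        simp only [mem_ofPred_eq, Pi.smul_apply, smul_eq_mul] at *
        rw [hv, mul_zero] }
  metric x u v :=
    conformalFactor κ x ^ 2 * (u 0 * v 0 + u 1 * v 1)
      + (u 3 + τ * conformalFactor κ x * (x 1 * u 0 - x 0 * u 1))
        * (v 3 + τ * conformalFactor κ x * (x 1 * v 0 - x 0 * v 1))
  xi _ := ![0, 0, 0, 1]

open Classical in
/-- The simply connected homogeneous space `𝔼(κ, τ)`: the total space of a fibration over `M²(κ)`
with bundle curvature `τ` and unit vertical Killing field `xi`. It is `M²(κ) × ℝ` if `τ = 0` (for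
`κ = τ = 0` this is the flat `ℝ² × ℝ`, given by the last formula), a Berger sphere if `κ > 0` and
`τ ≠ 0`, the Heisenberg group if `κ = 0` and `τ ≠ 0`, and the universal cover of `SL(2, ℝ)` if
`κ < 0` and `τ ≠ 0`. -/
def homogeneousSpace (κ τ : ℝ) : FiberedModel (Fin 4 → ℝ) :=
  if κ ≠ 0 ∧ τ = 0 then productSpace κ
  else if 0 < κ then bergerSphere κ τ
  else cartanSpace κ τ

/-! ### Vertical planes and slices of `M²(κ) × ℝ` -/

/-- `c` is a complete geodesic of `M²(κ)`, defined on all of `ℝ`. -/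
def IsCompleteGeodesic (κ : ℝ) (c : ℝ → Fin 3 → ℝ) : Prop :=
  (surfaceModel κ).IsGeodesicOn c univ

/-- The product of the curve `c` with `ℝ`. It is a vertical plane if `c` is a complete geodesic. -/
def verticalPlane (c : ℝ → Fin 3 → ℝ) : Set (Fin 4 → ℝ) := {x | base x ∈ range c}

/-- The tangent plane at `x` of the product of the curve `c` with `ℝ`. -/
def verticalPlaneTangent (c : ℝ → Fin 3 → ℝ) (x : Fin 4 → ℝ) : Set (Fin 4 → ℝ) :=
  {v | ∃ s r : ℝ, c s = base x ∧ base v = r • deriv c s}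

/-- The slice (horizontal plane) `M²(κ) × {z₀}`. -/
def slice (κ z₀ : ℝ) : Set (Fin 4 → ℝ) := {x | x ∈ (productSpace κ).carrier ∧ x 3 = z₀}

/-- The tangent plane at `x` of the slice through `x`. -/
def sliceTangent (κ : ℝ) (x : Fin 4 → ℝ) : Set (Fin 4 → ℝ) :=
  {v | v ∈ (productSpace κ).tangent x ∧ v 3 = 0}

/-! ### Isometric immersions of surfaces -/

section Immersions

variable {S : Type*} [TopologicalSpace S] [ChartedSpace (EuclideanSpace ℝ (Fin 2)) S]
  [IsManifold (𝓡 2) ∞ S]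

/-- A Riemannian metric on the surface `S`. -/
abbrev SurfaceMetric (S : Type*) [TopologicalSpace S]
    [ChartedSpace (EuclideanSpace ℝ (Fin 2)) S] [IsManifold (𝓡 2) ∞ S] :=
  Bundle.ContMDiffRiemannianMetric (𝓡 2) ∞ (EuclideanSpace ℝ (Fin 2))
    (fun p : S => TangentSpace (𝓡 2) p)

/-- The smooth field `J` of rotations of angle `π/2` in the tangent planes of the Riemannian
surface `(S, h)` that belongs to one of the orientations of `S`. -/
structure RightAngleRotation (h : SurfaceMetric S) where
  J : ∀ p : S, TangentSpace (𝓡 2) p →L[ℝ] TangentSpace (𝓡 2) p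
  sq : ∀ (p : S) (u : TangentSpace (𝓡 2) p), J p (J p u) = -u
  isometry : ∀ (p : S) (u v : TangentSpace (𝓡 2) p), h.inner p (J p u) (J p v) = h.inner p u v
  smooth : ContMDiff (𝓡 2)
    ((𝓡 2).prod 𝓘(ℝ, EuclideanSpace ℝ (Fin 2) →L[ℝ] EuclideanSpace ℝ (Fin 2))) ∞
    (fun p : S => Bundle.TotalSpace.mk'
      (EuclideanSpace ℝ (Fin 2) →L[ℝ] EuclideanSpace ℝ (Fin 2))
      (E := fun p : S => TangentSpace (𝓡 2) p →L[ℝ] TangentSpace (𝓡 2) p) p (J p))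

/-- The rotation `e^{θJ} = cos θ + sin θ J` of angle `θ` in the tangent plane at `p`. -/
def RightAngleRotation.rotation {h : SurfaceMetric S} (J : RightAngleRotation h) (θ : ℝ) (p : S)
    (u : TangentSpace (𝓡 2) p) : TangentSpace (𝓡 2) p :=
  Real.cos θ • u + Real.sin θ • J.J p u

variable {V : Type} [NormedAddCommGroup V] [NormedSpace ℝ V]

/-- The differential of a map from the surface to the vector space `V`. -/
def differential (f : S → V) (p : S) (u : TangentSpace (𝓡 2) p) : V :=
  mfderiv (𝓡 2) 𝓘(ℝ, V) f p u

/-- A smooth isometric immersion `φ` of `(S, h)` into the space `M`, with a smooth unit normal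
field `N`. -/
structure IsometricImmersion (M : FiberedModel V) (h : SurfaceMetric S) where
  φ : S → V
  N : S → V
  smooth : ContMDiff (𝓡 2) 𝓘(ℝ, V) ∞ φ
  mem : ∀ p, φ p ∈ M.carrier
  isometric : ∀ (p : S) (u v : TangentSpace (𝓡 2) p),
    M.metric (φ p) (differential φ p u) (differential φ p v) = h.inner p u v
  smooth_normal : ContMDiff (𝓡 2) 𝓘(ℝ, V) ∞ N
  normal_mem : ∀ p, N p ∈ M.tangent (φ p)
  normal_unit : ∀ p, M.metric (φ p) (N p) (N p) = 1
  normal_orthogonal : ∀ (p : S) (u : TangentSpace (𝓡 2) p),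
    M.metric (φ p) (N p) (differential φ p u) = 0

namespace IsometricImmersion

variable {M : FiberedModel V} {h : SurfaceMetric S}

/-- The angle function `ν = ⟨N, ξ⟩`. -/
def angle (F : IsometricImmersion M h) (p : S) : ℝ := M.metric (F.φ p) (F.N p) (M.xi (F.φ p))

/-- `T` is the tangent part `ξ - ν N` of the vertical field. -/
def IsTangentPart (F : IsometricImmersion M h) (T : ∀ p : S, TangentSpace (𝓡 2) p) : Prop :=
  ∀ p, differential F.φ p (T p) = M.xi (F.φ p) - F.angle p • F.N p

/-- `A` is the shape operator, `A u = -∇_u N`. -/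
def IsShapeOperator (F : IsometricImmersion M h)
    (A : ∀ p : S, TangentSpace (𝓡 2) p →ₗ[ℝ] TangentSpace (𝓡 2) p) : Prop :=
  ∀ (p : S) (u v : TangentSpace (𝓡 2) p),
    h.inner p (A p u) v = -M.covDeriv (F.φ p) (differential F.φ p u) (F.N p)
      (differential F.N p u) (differential F.φ p v)

/-- The mean curvature (half the trace of the shape operator) is constant, equal to `H`. -/
def IsCMC (F : IsometricImmersion M h) (H : ℝ) : Prop :=
  ∃ A, F.IsShapeOperator A ∧ ∀ p, LinearMap.trace ℝ (TangentSpace (𝓡 2) p) (A p) = 2 * H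

/-- `F` is minimal. -/
def IsMinimal (F : IsometricImmersion M h) : Prop := F.IsCMC 0

/-- The immersion meets orthogonally, at the point `p`, a surface with tangent plane `P` at
`φ(p)`: every normal vector of `P` is orthogonal to the normal `N` of the immersion. -/
def MeetsOrthogonally (F : IsometricImmersion M h) (p : S) (P : Set V) : Prop :=
  ∀ n ∈ M.tangent (F.φ p), (∀ v ∈ P, M.metric (F.φ p) n v = 0) → M.metric (F.φ p) n (F.N p) = 0

/-- `F'` (of constant mean curvature `H'`) is a sister immersion of `F` (of constant mean
curvature `H`), with phase angle `θ`: `ν' = ν`, `T' = e^{θJ} T` and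
`A' = e^{θJ} (A - H id) + H' id`, with `A`, `A'` the shape operators. -/
def IsSister (J : RightAngleRotation h) (θ H H' : ℝ) {M' : FiberedModel V}
    (F : IsometricImmersion M h) (F' : IsometricImmersion M' h) : Prop :=
  F.IsCMC H ∧ F'.IsCMC H' ∧ (∀ p, F'.angle p = F.angle p) ∧
  (∃ T T', F.IsTangentPart T ∧ F'.IsTangentPart T' ∧ ∀ p, T' p = J.rotation θ p (T p)) ∧
  ∃ A A', F.IsShapeOperator A ∧ F'.IsShapeOperator A' ∧
    ∀ (p : S) (u : TangentSpace (𝓡 2) p), A' p u = J.rotation θ p (A p u - H • u) + H' • u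

end IsometricImmersion

end Immersions

end SisterSurface

end

/-!
The idea is to follow the conormal `φ'_* (J α')` of the curve `α` in the sister immersion `φ'` into
`M²(ε) × ℝ ⊆ ℝ⁴`.

*Vertical geodesics.* The normal of `φ` is orthogonal to `ξ`, so `ν = 0`, and `α'` is a multiple of
`T`. Hence `ν' = 0`, which says that `φ'` meets the slices orthogonally, and `α'` is orthogonal to
`T' = JT`, which says that the height of `φ'` is constant along `α`
(`IsSister.slice_of_vertical`).

*Horizontal geodesics.* Let `B = φ'_* (J α') / |α'|`.
* `B` is horizontal: `⟨φ'_* (J α'), ξ⟩ = h(J α', JT) = h(α', T) = ⟨φ_* α', ξ⟩ = 0`.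
* The normal curvature of `α` in `φ` vanishes, that is, `h(S α', α') = 0`
  (`inner_shapeOperator_velocity`), so `h(S' α', J α') = h(J S α' + H α', J α') = 0`, and the
  derivative of `B` is orthogonal to `N'`.
* The geodesic curvature of `α` vanishes. It depends only on the metric of the surface
  (`acceleration_eq_acceleration`, from the Koszul formula
  `metric_second_derivative_add_christoffel` in a chart), so the derivative of `B` is orthogonal to
  the velocity of `φ' ∘ α`.
* As `B` is horizontal and tangent, orthogonal to the velocity, and of unit length, its derivative
  in `ℝ⁴` is also orthogonal to `ξ`, to the position vector in `M²(ε)`, and to `B`.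

So `B` is a constant vector of `ℝ⁴` (`IsSister.exists_constant_conormal`), and the projection of
`φ' ∘ α` to `M²(ε)` lies in the section of `M²(ε)` by the plane through the origin orthogonal to
`B`, which is a complete geodesic (`exists_completeGeodesic`). The vertical plane over it has normal
`B`, which is orthogonal to `N'`.

The homogeneous space that contains `φ` enters through properties common to all its models, collected
in `MetricModel.IsRegular` (`homogeneousSpace_isRegular`).
-/

noncomputable section

namespace SisterSurface

/-! ### Calculus of metrics -/

/-- A model in `ℝ⁴` whose metric is bilinear, symmetric and differentiable in the base point, and
whose tangent spaces contain the velocities of all curves that stay in the carrier. -/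
structure MetricModel.IsRegular (M : MetricModel (Fin 4 → ℝ)) : Prop where
  symm : ∀ x u v, M.metric x u v = M.metric x v u
  add_left : ∀ x u v w, M.metric x (u + v) w = M.metric x u w + M.metric x v w
  smul_left : ∀ x (c : ℝ) u w, M.metric x (c • u) w = c * M.metric x u w
  differentiableAt : ∀ x ∈ M.carrier, ∀ u v, DifferentiableAt ℝ (fun y => M.metric y u v) x
  mem_tangent : ∀ (β : ℝ → Fin 4 → ℝ) (w : Fin 4 → ℝ), HasDerivAt β w 0 →
    (∀ s, β s ∈ M.carrier) → w ∈ M.tangent (β 0)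

namespace MetricModel.IsRegular

variable {M : MetricModel (Fin 4 → ℝ)} (hM : M.IsRegular)
include hM

lemma add_right (x u v w : Fin 4 → ℝ) :
    M.metric x u (v + w) = M.metric x u v + M.metric x u w := by
  rw [hM.symm, hM.add_left, hM.symm x v, hM.symm x w]

lemma smul_right (x : Fin 4 → ℝ) (c : ℝ) (u w : Fin 4 → ℝ) :
    M.metric x u (c • w) = c * M.metric x u w := by
  rw [hM.symm, hM.smul_left, hM.symm x w]

lemma sub_right (x u v w : Fin 4 → ℝ) :
    M.metric x u (v - w) = M.metric x u v - M.metric x u w := by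
  rw [sub_eq_add_neg, ← neg_one_smul ℝ w, hM.add_right, hM.smul_right]
  ring

lemma metric_eq_sum (x u v : Fin 4 → ℝ) :
    M.metric x u v =
      ∑ i, ∑ j, u i * v j * M.metric x (Pi.single i 1) (Pi.single j 1) := by
  have key : ∀ w : Fin 4 → ℝ, w = ∑ i, w i • (Pi.single i 1 : Fin 4 → ℝ) := fun w => by
    ext j; simp [Finset.sum_apply, Pi.single_apply]
  let L : (Fin 4 → ℝ) →ₗ[ℝ] (Fin 4 → ℝ) →ₗ[ℝ] ℝ :=
    LinearMap.mk₂ ℝ (M.metric x) (hM.add_left x) (hM.smul_left x) (hM.add_right x)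
      (fun c u w => hM.smul_right x c u w)
  have hL : ∀ u v, M.metric x u v = L u v := fun _ _ => rfl
  rw [hL]
  conv_lhs => rw [key u, key v]
  simp only [map_sum, map_smul, LinearMap.sum_apply, LinearMap.smul_apply, smul_eq_mul, hL,
    Finset.mul_sum]
  rw [Finset.sum_comm]
  refine Finset.sum_congr rfl fun i _ => Finset.sum_congr rfl fun j _ => by ring

/-- The product rule for `g(u, v)` along a curve. -/
lemma hasDerivWithinAt_metric {x u v : ℝ → Fin 4 → ℝ} {x' u' v' : Fin 4 → ℝ} {I : Set ℝ} {t : ℝ}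
    (hx : HasDerivWithinAt x x' I t) (hu : HasDerivWithinAt u u' I t)
    (hv : HasDerivWithinAt v v' I t) (hxt : x t ∈ M.carrier) :
    HasDerivWithinAt (fun s => M.metric (x s) (u s) (v s))
      (fderiv ℝ (fun y => M.metric y (u t) (v t)) (x t) x' + M.metric (x t) u' (v t)
        + M.metric (x t) (u t) v') I t := by
  have hg : ∀ i j, HasFDerivAt (fun y => M.metric y (Pi.single i 1) (Pi.single j 1))
      (fderiv ℝ (fun y => M.metric y (Pi.single i 1) (Pi.single j 1)) (x t)) (x t) :=
    fun i j => (hM.differentiableAt _ hxt _ _).hasFDerivAt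
  have h1 : HasFDerivAt (fun y => M.metric y (u t) (v t))
      (∑ i, ∑ j, (u t i * v t j) •
        fderiv ℝ (fun y => M.metric y (Pi.single i 1) (Pi.single j 1)) (x t)) (x t) := by
    simp_rw [fun y => hM.metric_eq_sum y (u t) (v t)]
    exact HasFDerivAt.fun_sum fun i _ => HasFDerivAt.fun_sum fun j _ =>
      (hg i j).const_mul (u t i * v t j)
  rw [h1.fderiv]
  simp_rw [fun s => hM.metric_eq_sum (x s) (u s) (v s)]
  rw [hM.metric_eq_sum (x t) u', hM.metric_eq_sum (x t) (u t) v']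
  have hu' := hasDerivWithinAt_pi.1 hu
  have hv' := hasDerivWithinAt_pi.1 hv
  refine (HasDerivWithinAt.fun_sum fun i (_ : i ∈ Finset.univ) =>
    HasDerivWithinAt.fun_sum fun j (_ : j ∈ Finset.univ) =>
      ((hu' i).mul (hv' j)).mul ((hg i j).comp_hasDerivWithinAt t hx)).congr_deriv ?_
  simp only [sum_apply, smul_apply, smul_eq_mul,
    ← Finset.sum_add_distrib, Pi.mul_apply, Function.comp]
  refine Finset.sum_congr rfl fun i _ => Finset.sum_congr rfl fun j _ => by ring

/-- The Levi-Civita connection is metric: where `g(W, γ') = 0` along `γ`, the covariant derivative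
of `W` paired with `γ'` is minus the acceleration of `γ` paired with `W`. -/
lemma covDeriv_add_acceleration {γ W : ℝ → Fin 4 → ℝ} {W' : Fin 4 → ℝ} {I : Set ℝ} {t : ℝ}
    (hI : UniqueDiffWithinAt ℝ I t) (htI : t ∈ I) (hγ : DifferentiableWithinAt ℝ γ I t)
    (hγ' : DifferentiableWithinAt ℝ (derivWithin γ I) I t)
    (hW : HasDerivWithinAt W W' I t) (hmem : γ t ∈ M.carrier)
    (h0 : ∀ s ∈ I, M.metric (γ s) (W s) (derivWithin γ I s) = 0) :
    M.covDeriv (γ t) (derivWithin γ I t) (W t) W' (derivWithin γ I t)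
      + M.acceleration γ I t (W t) = 0 := by
  have h1 := hM.hasDerivWithinAt_metric hγ.hasDerivWithinAt hW hγ'.hasDerivWithinAt hmem
  have h2 : HasDerivWithinAt (fun s => M.metric (γ s) (W s) (derivWithin γ I s)) 0 I t :=
    (hasDerivWithinAt_const t I (0 : ℝ)).congr h0 (h0 t htI)
  have h3 := hI.eq_deriv _ h1 h2
  simp only [acceleration, covDeriv, christoffel]
  have e : (fun y => M.metric y (derivWithin γ I t) (W t))
      = fun y => M.metric y (W t) (derivWithin γ I t) := by ext y; exact hM.symm _ _ _
  rw [e, hM.symm (γ t) (derivWithin (fun s => derivWithin γ I s) I t)]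
  change _ + _ + M.metric (γ t) (W t) (derivWithin (fun s => derivWithin γ I s) I t) = 0 at h3
  linear_combination h3

/-- Koszul formula for the second fundamental form of a parametrized submanifold `f`, in the
constant fields `u`, `v` of the parameter domain: the right-hand side involves only the metric
induced by `f`. -/
lemma metric_second_derivative_add_christoffel {E : Type*} [NormedAddCommGroup E]
    [NormedSpace ℝ E] {f : E → Fin 4 → ℝ} {q : E} (hf : ContDiffAt ℝ 2 f q)
    (hmem : f q ∈ M.carrier) (u v : E) :
    M.metric (f q) (fderiv ℝ (fderiv ℝ f) q u u) (fderiv ℝ f q v)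
        + M.christoffel (f q) (fderiv ℝ f q u) (fderiv ℝ f q u) (fderiv ℝ f q v)
      = deriv (fun s : ℝ => M.metric (f (q + s • u)) (fderiv ℝ f (q + s • u) u)
            (fderiv ℝ f (q + s • u) v)) 0
        - deriv (fun s : ℝ => M.metric (f (q + s • v)) (fderiv ℝ f (q + s • v) u)
            (fderiv ℝ f (q + s • v) u)) 0 / 2 := by
  have hline : ∀ w : E, HasDerivAt (fun s : ℝ => q + s • w) w 0 := fun w => by
    simpa using ((hasDerivAt_id (0 : ℝ)).smul_const w).const_add q
  have hf1 : HasFDerivAt f (fderiv ℝ f q) q := (hf.differentiableAt (by simp)).hasFDerivAt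
  have hf2 : HasFDerivAt (fderiv ℝ f) (fderiv ℝ (fderiv ℝ f) q) q :=
    ((hf.fderiv_right (m := 1) (by norm_num)).differentiableAt (by simp)).hasFDerivAt
  have hsymm : fderiv ℝ (fderiv ℝ f) q v u = fderiv ℝ (fderiv ℝ f) q u v :=
    (hf.isSymmSndFDerivAt (by simp)).eq v u
  have h1 : ∀ w, HasDerivAt (fun s : ℝ => f (q + s • w)) (fderiv ℝ f q w) 0 := fun w =>
    HasFDerivAt.comp_hasDerivAt (f := fun s : ℝ => q + s • w) 0 (by simpa using hf1) (hline w)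
  have h2 : ∀ w z, HasDerivAt (fun s : ℝ => fderiv ℝ f (q + s • w) z)
      (fderiv ℝ (fderiv ℝ f) q w z) 0 := fun w z => by
    have := HasFDerivAt.comp_hasDerivAt (f := fun s : ℝ => q + s • w) 0
      (by simpa using hf2) (hline w)
    simpa using this.clm_apply (hasDerivAt_const (0 : ℝ) z)
  have hD : ∀ w y z, deriv (fun s : ℝ => M.metric (f (q + s • w)) (fderiv ℝ f (q + s • w) y)
      (fderiv ℝ f (q + s • w) z)) 0
      = fderiv ℝ (fun p => M.metric p (fderiv ℝ f q y) (fderiv ℝ f q z)) (f q) (fderiv ℝ f q w)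
        + M.metric (f q) (fderiv ℝ (fderiv ℝ f) q w y) (fderiv ℝ f q z)
        + M.metric (f q) (fderiv ℝ f q y) (fderiv ℝ (fderiv ℝ f) q w z) := fun w y z => by
    have := hM.hasDerivWithinAt_metric (h1 w).hasDerivWithinAt (h2 w y).hasDerivWithinAt
      (h2 w z).hasDerivWithinAt (I := univ) (by simpa using hmem)
    rw [(hasDerivWithinAt_univ.1 this).deriv]
    simp
  rw [hD, hD, hsymm, hM.symm (f q) (fderiv ℝ (fderiv ℝ f) q u v)]
  simp only [christoffel]
  ring

end MetricModel.IsRegular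

/-! ### Regularity of the homogeneous spaces -/

lemma productSpace_metric (κ : ℝ) (x u v : Fin 4 → ℝ) :
    (productSpace κ).metric x u v
      = u 0 * v 0 + u 1 * v 1 + κ.sign * (u 2 * v 2) + u 3 * v 3 := rfl

lemma mem_productSpace_carrier {κ : ℝ} {x : Fin 4 → ℝ} :
    x ∈ (productSpace κ).carrier ↔
      κ * (x 0 ^ 2 + x 1 ^ 2 + κ.sign * x 2 ^ 2) = 1 ∧ (κ < 0 → 0 < x 2) := Iff.rfl

lemma mem_productSpace_tangent {κ : ℝ} {x v : Fin 4 → ℝ} :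
    v ∈ (productSpace κ).tangent x ↔ x 0 * v 0 + x 1 * v 1 + κ.sign * (x 2 * v 2) = 0 := Iff.rfl

lemma productSpace_metric_xi (κ : ℝ) (x u y : Fin 4 → ℝ) :
    (productSpace κ).metric x u ((productSpace κ).xi y) = u 3 := by
  rw [productSpace_metric]
  simp [productSpace]

lemma productSpace_isRegular {κ : ℝ} (hκ : κ ≠ 0) : (productSpace κ).IsRegular where
  symm x u v := by simp only [productSpace_metric]; ring
  add_left x u v w := by simp only [productSpace_metric, Pi.add_apply]; ring
  smul_left x c u w := by simp only [productSpace_metric, Pi.smul_apply, smul_eq_mul]; ring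
  differentiableAt x _ u v := by simp only [productSpace_metric]; fun_prop
  mem_tangent β w hβ hmem := by
    have h := hasDerivAt_pi.1 hβ
    have h1 := (((h 0).pow 2).add ((h 1).pow 2)).add (((h 2).pow 2).const_mul κ.sign)
    have h2 := h1.const_mul κ
    have h3 := h2.unique ((hasDerivAt_const (0 : ℝ) (1 : ℝ)).congr_of_eventuallyEq
      (Filter.Eventually.of_forall fun s => (mem_productSpace_carrier.1 (hmem s)).1))
    rw [mem_productSpace_tangent]
    refine mul_left_cancel₀ (mul_ne_zero two_ne_zero hκ) ?_
    norm_num at h3 ⊢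
    rcases h3 with h3 | h3
    · exact absurd h3 hκ
    · right
      linear_combination h3 / 2

lemma bergerSphere_isRegular (κ τ : ℝ) : (bergerSphere κ τ).IsRegular where
  symm x u v := by simp only [bergerSphere, dotProduct_comm u v]; ring
  add_left x u v w := by simp only [bergerSphere, add_dotProduct]; ring
  smul_left x c u w := by simp only [bergerSphere, smul_dotProduct, smul_eq_mul]; ring
  differentiableAt x _ u v := by
    simp only [bergerSphere, hopfField, dotProduct, Fin.sum_univ_four]
    simp only [Matrix.cons_val]
    fun_prop
  mem_tangent β w hβ hmem := by
    have h := hasDerivAt_pi.1 hβ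
    have h1 := ((((h 0).pow 2).add ((h 1).pow 2)).add ((h 2).pow 2)).add ((h 3).pow 2)
    have h3 := h1.unique ((hasDerivAt_const (0 : ℝ) (1 : ℝ)).congr_of_eventuallyEq
      (Filter.Eventually.of_forall fun s => by
        have := hmem s
        simp only [bergerSphere, mem_ofPred_eq, dotProduct, Fin.sum_univ_four] at this
        simp only [Pi.add_apply, Pi.pow_apply]
        linear_combination this))
    change β 0 ⬝ᵥ w = 0
    simp only [dotProduct, Fin.sum_univ_four]
    norm_num at h3
    linear_combination h3 / 2

lemma cartanSpace_isRegular (κ τ : ℝ) : (cartanSpace κ τ).IsRegular where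
  symm x u v := by simp only [cartanSpace]; ring
  add_left x u v w := by simp only [cartanSpace, Pi.add_apply]; ring
  smul_left x c u w := by simp only [cartanSpace, Pi.smul_apply, smul_eq_mul]; ring
  differentiableAt x hx u v := by
    have h : DifferentiableAt ℝ (conformalFactor κ) x := by
      have h1 : DifferentiableAt ℝ (fun y : Fin 4 → ℝ => 1 + κ / 4 * (y 0 ^ 2 + y 1 ^ 2)) x := by
        fun_prop
      have h2 := h1.fun_inv hx.2.ne'
      simp only [← one_div] at h2
      exact h2
    simp only [cartanSpace]
    fun_prop
  mem_tangent β w hβ hmem :=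
    (hasDerivAt_pi.1 hβ 2).unique ((hasDerivAt_const (0 : ℝ) (0 : ℝ)).congr_of_eventuallyEq
      (Filter.Eventually.of_forall fun s => (hmem s).1))

lemma homogeneousSpace_isRegular (κ τ : ℝ) : (homogeneousSpace κ τ).IsRegular := by
  unfold homogeneousSpace
  split_ifs with h1 h2
  · exact productSpace_isRegular h1.1
  · exact bergerSphere_isRegular κ τ
  · exact cartanSpace_isRegular κ τ

lemma productSpace_covDeriv (κ : ℝ) (x u w dw z : Fin 4 → ℝ) :
    (productSpace κ).covDeriv x u w dw z = (productSpace κ).metric x dw z := by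
  simp [MetricModel.covDeriv, MetricModel.christoffel, productSpace_metric]

lemma surfaceModel_covDeriv (κ : ℝ) (x u w dw z : Fin 3 → ℝ) :
    (surfaceModel κ).covDeriv x u w dw z = (surfaceModel κ).metric x dw z := by
  simp [MetricModel.covDeriv, MetricModel.christoffel, surfaceModel]

/-! ### Complete geodesics of `M²(±1)` -/

/-- Vectors orthogonal to an orthogonal frame of nonnull vectors, for a nondegenerate diagonal
bilinear form, vanish. -/
lemma eq_zero_of_orthogonal_frame {n : ℕ} (η : Fin n → ℝ)
    (e : Fin n → Fin n → ℝ) (horth : ∀ i j, i ≠ j → ∑ k, η k * e i k * e j k = 0)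
    (hne : ∀ i, ∑ k, η k * e i k * e i k ≠ 0) (w : Fin n → ℝ)
    (hw : ∀ i, ∑ k, η k * e i k * w k = 0) : w = 0 := by
  let P : Matrix (Fin n) (Fin n) ℝ := fun i k => η k * e i k
  have hP : P * (Matrix.of e).transpose
      = Matrix.diagonal fun i => ∑ k, η k * e i k * e i k := by
    ext i j
    rw [Matrix.mul_apply, Matrix.diagonal_apply]
    split_ifs with hij
    · subst hij; rfl
    · exact horth i j hij
  have hdet : P.det ≠ 0 := by
    intro h0
    have := congrArg Matrix.det hP
    rw [Matrix.det_mul, h0, zero_mul, Matrix.det_diagonal] at this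
    exact Finset.prod_ne_zero_iff.2 (fun i _ => hne i) this.symm
  exact Matrix.eq_zero_of_mulVec_eq_zero hdet (funext hw)

/-- The bilinear form `x₀ y₀ + x₁ y₁ + ε x₂ y₂` of `ℝ³`, which for `ε = ±1` induces the metric
of `M²(ε)`. -/
def ambientForm (ε : ℝ) (x y : Fin 3 → ℝ) : ℝ := x 0 * y 0 + x 1 * y 1 + ε * (x 2 * y 2)

lemma sign_eq_self {ε : ℝ} (hε : ε = -1 ∨ ε = 1) : ε.sign = ε := by
  rcases hε with rfl | rfl
  · exact Real.sign_of_neg (by norm_num)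
  · exact Real.sign_of_pos (by norm_num)

/-- Expansion of a vector in an orthogonal frame made of a point of `M²(ε)` and two unit
vectors. -/
lemma eq_frame_expansion {ε : ℝ} (hε : ε = -1 ∨ ε = 1) {x e b : Fin 3 → ℝ}
    (hxx : ambientForm ε x x = ε) (hee : ambientForm ε e e = 1) (hbb : ambientForm ε b b = 1)
    (hxe : ambientForm ε x e = 0) (hxb : ambientForm ε x b = 0) (heb : ambientForm ε e b = 0)
    (w : Fin 3 → ℝ) :
    w = (ε * ambientForm ε w x) • x + ambientForm ε w e • e + ambientForm ε w b • b := by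
  have hε2 : ε * ε = 1 := by rcases hε with rfl | rfl <;> norm_num
  have hε0 : ε ≠ 0 := by rcases hε with rfl | rfl <;> norm_num
  rw [← sub_eq_zero]
  simp only [ambientForm] at *
  refine eq_zero_of_orthogonal_frame ![1, 1, ε] ![x, e, b] ?_ ?_ _ ?_
  · intro i j hij
    fin_cases i <;> fin_cases j <;> simp [Fin.sum_univ_three] at hij ⊢ <;> linarith
  · intro i
    fin_cases i <;> simp [Fin.sum_univ_three]
    · rw [show x 0 * x 0 + x 1 * x 1 + ε * x 2 * x 2 = ε by linarith]; exact hε0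
    · rw [show e 0 * e 0 + e 1 * e 1 + ε * e 2 * e 2 = 1 by linarith]; exact one_ne_zero
    · rw [show b 0 * b 0 + b 1 * b 1 + ε * b 2 * b 2 = 1 by linarith]; exact one_ne_zero
  · intro i
    fin_cases i <;> simp [Fin.sum_univ_three]
    · linear_combination (-ε * (w 0 * x 0 + w 1 * x 1 + ε * (w 2 * x 2))) * hxx
        - (w 0 * e 0 + w 1 * e 1 + ε * (w 2 * e 2)) * hxe
        - (w 0 * b 0 + w 1 * b 1 + ε * (w 2 * b 2)) * hxb
        - (w 0 * x 0 + w 1 * x 1 + ε * (w 2 * x 2)) * hε2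
    · linear_combination (-ε * (w 0 * x 0 + w 1 * x 1 + ε * (w 2 * x 2))) * hxe
        - (w 0 * e 0 + w 1 * e 1 + ε * (w 2 * e 2)) * hee
        - (w 0 * b 0 + w 1 * b 1 + ε * (w 2 * b 2)) * heb
    · linear_combination (-ε * (w 0 * x 0 + w 1 * x 1 + ε * (w 2 * x 2))) * hxb
        - (w 0 * e 0 + w 1 * e 1 + ε * (w 2 * e 2)) * heb
        - (w 0 * b 0 + w 1 * b 1 + ε * (w 2 * b 2)) * hbb

lemma mem_surfaceModel_carrier {ε : ℝ} (hε : ε = -1 ∨ ε = 1) {x : Fin 3 → ℝ} :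
    x ∈ (surfaceModel ε).carrier ↔ ambientForm ε x x = ε ∧ (ε = -1 → 0 < x 2) := by
  simp only [surfaceModel, sign_eq_self hε, mem_ofPred_eq, ambientForm]
  rcases hε with rfl | rfl
  · refine and_congr ⟨fun h => ?_, fun h => ?_⟩ (by norm_num) <;> linarith
  · refine and_congr ⟨fun h => ?_, fun h => ?_⟩ (by norm_num) <;> linarith

/-- The plane section `M²(ε) ∩ b^⊥`, for a unit vector `b` tangent at `x₀ ∈ M²(ε)`, is
parametrized by a complete unit speed geodesic, whose velocities are orthogonal to `b` too. -/
lemma exists_completeGeodesic {ε : ℝ} (hε : ε = -1 ∨ ε = 1) {x₀ b : Fin 3 → ℝ}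
    (hx₀ : x₀ ∈ (surfaceModel ε).carrier) (hbb : ambientForm ε b b = 1)
    (hxb : ambientForm ε x₀ b = 0) :
    ∃ c : ℝ → Fin 3 → ℝ, IsCompleteGeodesic ε c ∧
      (∀ x ∈ (surfaceModel ε).carrier, ambientForm ε x b = 0 → x ∈ range c) ∧
      ∀ s, ambientForm ε (deriv c s) (deriv c s) = 1 ∧ ambientForm ε (c s) (deriv c s) = 0 ∧
        ambientForm ε (deriv c s) b = 0 := by
  have hmem := (mem_surfaceModel_carrier hε).1 hx₀
  -- The second frame vector is the cross product of `b` and `x₀` for the form.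
  obtain ⟨e, he⟩ : ∃ e : Fin 3 → ℝ, e = ![b 1 * x₀ 2 - b 2 * x₀ 1, b 2 * x₀ 0 - b 0 * x₀ 2,
    ε * (b 0 * x₀ 1 - b 1 * x₀ 0)] := ⟨_, rfl⟩
  have e0 : e 0 = b 1 * x₀ 2 - b 2 * x₀ 1 := by simp [he]
  have e1 : e 1 = b 2 * x₀ 0 - b 0 * x₀ 2 := by simp [he]
  have e2 : e 2 = ε * (b 0 * x₀ 1 - b 1 * x₀ 0) := by simp [he]
  have hε2 : ε * ε = 1 := by rcases hε with rfl | rfl <;> norm_num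
  have hxe : ambientForm ε x₀ e = 0 := by
    simp only [ambientForm, e0, e1, e2]
    linear_combination (x₀ 2 * (b 0 * x₀ 1 - b 1 * x₀ 0)) * hε2
  have heb : ambientForm ε e b = 0 := by
    simp only [ambientForm, e0, e1, e2]
    linear_combination (b 2 * (b 0 * x₀ 1 - b 1 * x₀ 0)) * hε2
  have hee : ambientForm ε e e = 1 := by
    have h1 := hmem.1
    have key : ambientForm ε e e
        = ε * (ambientForm ε b b * ambientForm ε x₀ x₀ - ambientForm ε x₀ b ^ 2) := by
      simp only [ambientForm, e0, e1, e2]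
      rcases hε with rfl | rfl <;> ring
    rw [key, hbb, hxb, h1]
    linear_combination hε2
  -- A curve `C x₀ + S e` with `C' = -ε S`, `S' = C` and `C² + ε S² = 1` has all the properties.
  have main : ∀ C D : ℝ → ℝ, ContDiff ℝ ∞ C → ContDiff ℝ ∞ D →
      (∀ s, HasDerivAt C (-ε * D s) s) → (∀ s, HasDerivAt D (C s) s) →
      (∀ s, C s ^ 2 + ε * D s ^ 2 = 1) → (ε = -1 → ∀ s, 0 < C s * x₀ 2 + D s * e 2) →
      (∀ p q : ℝ, p ^ 2 + ε * q ^ 2 = 1 → (ε = -1 → 0 < p) → ∃ s, C s = p ∧ D s = q) →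
      (∀ x ∈ (surfaceModel ε).carrier, ε = -1 → ambientForm ε x x₀ < 0) →
      ∃ c : ℝ → Fin 3 → ℝ, IsCompleteGeodesic ε c ∧
      (∀ x ∈ (surfaceModel ε).carrier, ambientForm ε x b = 0 → x ∈ range c) ∧
      ∀ s, ambientForm ε (deriv c s) (deriv c s) = 1 ∧ ambientForm ε (c s) (deriv c s) = 0 ∧
        ambientForm ε (deriv c s) b = 0 := by
    intro C D hC hD hC' hD' hCD hpos hsurj hneg
    have hc' : ∀ s, HasDerivAt (fun s => C s • x₀ + D s • e) ((-ε * D s) • x₀ + C s • e) s :=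
      fun s => ((hC' s).smul_const x₀).add ((hD' s).smul_const e)
    have hc'' : ∀ s, HasDerivAt (fun s => (-ε * D s) • x₀ + C s • e)
        ((-ε) • (C s • x₀ + D s • e)) s := fun s => by
      refine ((((hD' s).const_mul (-ε)).smul_const x₀).add ((hC' s).smul_const e)).congr_deriv ?_
      module
    have hd : deriv (fun s => C s • x₀ + D s • e) = fun s => (-ε * D s) • x₀ + C s • e :=
      funext fun s => (hc' s).deriv
    have hunit : ∀ s, ambientForm ε ((-ε * D s) • x₀ + C s • e) ((-ε * D s) • x₀ + C s • e)
        = 1 := fun s => by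
      have h1 := hmem.1
      have := hCD s
      simp only [ambientForm, Pi.add_apply, Pi.smul_apply, smul_eq_mul] at *
      linear_combination (ε ^ 2 * D s ^ 2) * h1 + C s ^ 2 * hee - 2 * ε * D s * C s * hxe
        + ε * D s ^ 2 * hε2 + this
    refine ⟨fun s => C s • x₀ + D s • e, ⟨?_, ?_, ?_, ?_⟩, ?_, ?_⟩
    · exact ((hC.smul contDiff_const).add (hD.smul contDiff_const)).contDiffOn
    · intro s _
      rw [mem_surfaceModel_carrier hε]
      refine ⟨?_, fun h => by simpa using hpos h s⟩
      have h1 := hmem.1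
      have := hCD s
      simp only [ambientForm, Pi.add_apply, Pi.smul_apply, smul_eq_mul] at *
      linear_combination (C s ^ 2) * h1 + D s ^ 2 * hee + 2 * D s * C s * hxe
        - D s ^ 2 * hε2 + ε * this
    · intro s _ h0
      rw [derivWithin_univ, hd] at h0
      have := hunit s
      simp only at h0
      rw [h0] at this
      simp [ambientForm] at this
    · intro s _ z hz
      rw [MetricModel.acceleration, surfaceModel_covDeriv]
      simp only [derivWithin_univ]
      rw [hd, (hc'' s).deriv]
      simp only [surfaceModel, sign_eq_self hε, Pi.smul_apply, smul_eq_mul] at hz ⊢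
      change _ = _ at hz
      linear_combination (-ε) * hz
    · intro x hx hxb'
      have hexp := eq_frame_expansion hε hmem.1 hee hbb hxe hxb heb x
      rw [hxb', zero_smul, add_zero] at hexp
      obtain ⟨s, hs1, hs2⟩ := hsurj (ε * ambientForm ε x x₀) (ambientForm ε x e) (by
        have h1 := hmem.1
        have h2 := ((mem_surfaceModel_carrier hε).1 hx).1
        have h3 : ambientForm ε x x = ε * ambientForm ε x x₀ * ambientForm ε x x₀
            + ambientForm ε x e * ambientForm ε x e := by
          conv_lhs => rw [hexp]
          simp only [ambientForm, Pi.add_apply, Pi.smul_apply, smul_eq_mul]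
          generalize hP : x 0 * x₀ 0 + x 1 * x₀ 1 + ε * (x 2 * x₀ 2) = P
          generalize hR : x 0 * e 0 + x 1 * e 1 + ε * (x 2 * e 2) = R
          simp only [ambientForm] at h1 hee hxe
          linear_combination (ε ^ 2 * P ^ 2) * h1 + R ^ 2 * hee + 2 * ε * P * R * hxe
            + ε * P ^ 2 * hε2
        rw [h2] at h3
        linear_combination (-ε) * h3 + hε2) (fun h => by
        have := hneg x hx h
        rw [h] at this ⊢
        linarith)
      exact ⟨s, by simp only [hs1, hs2]; exact hexp.symm⟩
    · intro s
      rw [hd]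
      refine ⟨hunit s, ?_, ?_⟩
      · have h1 := hmem.1
        simp only [ambientForm, Pi.add_apply, Pi.smul_apply, smul_eq_mul] at *
        linear_combination (-ε * D s * C s) * h1 + (C s ^ 2 - ε * D s ^ 2) * hxe
          + C s * D s * hee - C s * D s * hε2
      · simp only [ambientForm, Pi.add_apply, Pi.smul_apply, smul_eq_mul] at *
        linear_combination (-ε * D s) * hxb + C s * heb
  rcases hε with rfl | rfl
  · have hx2 : 0 < x₀ 2 := hmem.2 rfl
    have hx1 := hmem.1
    refine main Real.cosh Real.sinh Real.contDiff_cosh Real.contDiff_sinh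
      (fun s => by simpa using Real.hasDerivAt_cosh s) Real.hasDerivAt_sinh
      (fun s => by have := Real.cosh_sq s; linarith) (fun _ s => ?_) (fun p q h hp => ?_)
      (fun x hx _ => ?_)
    · simp only [ambientForm] at hx1 hee hxe
      have he2 : e 2 ^ 2 < x₀ 2 ^ 2 := by
        have : e 2 ^ 2 + 1 + (x₀ 0 * e 1 - x₀ 1 * e 0) ^ 2 = x₀ 2 ^ 2 := by
          linear_combination (e 0 ^ 2 + e 1 ^ 2) * hx1 + (x₀ 2 ^ 2 - 1) * hee
            - (x₀ 0 * e 0 + x₀ 1 * e 1 + x₀ 2 * e 2) * hxe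
        linarith [sq_nonneg (x₀ 0 * e 1 - x₀ 1 * e 0)]
      have he2' : |e 2| < x₀ 2 := abs_lt_of_sq_lt_sq he2 hx2.le
      have hs : |Real.sinh s| ≤ Real.cosh s :=
        abs_le_of_sq_le_sq (by have := Real.cosh_sq s; linarith) (Real.cosh_pos s).le
      have h1 : -(Real.sinh s * e 2) ≤ |Real.sinh s| * |e 2| := by
        rw [← abs_mul]; exact neg_le_abs _
      have h2 : |Real.sinh s| * |e 2| < Real.cosh s * x₀ 2 :=
        lt_of_le_of_lt (mul_le_mul_of_nonneg_right hs (abs_nonneg _))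
          (mul_lt_mul_of_pos_left he2' (Real.cosh_pos s))
      linarith
    · refine ⟨Real.arsinh q, ?_, Real.sinh_arsinh q⟩
      rw [Real.cosh_arsinh, show 1 + q ^ 2 = p ^ 2 by linarith]
      exact Real.sqrt_sq (hp rfl).le
    · obtain ⟨h1, h2⟩ := (mem_surfaceModel_carrier (Or.inl rfl)).1 hx
      have h2 := h2 rfl
      simp only [ambientForm] at h1 hx1 ⊢
      have : (x 0 * x₀ 0 + x 1 * x₀ 1) ^ 2 < (x 2 * x₀ 2) ^ 2 := by
        nlinarith [sq_nonneg (x 0 * x₀ 1 - x 1 * x₀ 0), sq_nonneg (x₀ 0), sq_nonneg (x₀ 1),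
          sq_nonneg (x 0), sq_nonneg (x 1), mul_pos h2 hx2]
      have := abs_lt_of_sq_lt_sq this (mul_pos h2 hx2).le
      linarith [le_abs_self (x 0 * x₀ 0 + x 1 * x₀ 1)]
  · refine main Real.cos Real.sin Real.contDiff_cos Real.contDiff_sin
      (fun s => by simpa using Real.hasDerivAt_cos s) Real.hasDerivAt_sin
      (fun s => by have := Real.sin_sq_add_cos_sq s; linarith) (fun h => by norm_num at h)
      (fun p q h _ => ?_) (fun _ _ h => by norm_num at h)
    -- An angle with given cosine and sine is an argument of `p + q i`.
    have hn : ‖(⟨p, q⟩ : ℂ)‖ = 1 := by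
      rw [Complex.norm_eq_sqrt_sq_add_sq, Real.sqrt_eq_one]
      simpa using h
    have h0 : (⟨p, q⟩ : ℂ) ≠ 0 := by
      intro h0; rw [h0] at hn; simp at hn
    refine ⟨Complex.arg ⟨p, q⟩, ?_, ?_⟩
    · rw [Complex.cos_arg h0, hn, div_one]
    · rw [Complex.sin_arg, hn, div_one]

section Immersions

variable {S : Type*} [TopologicalSpace S] [ChartedSpace (EuclideanSpace ℝ (Fin 2)) S]
  [IsManifold (𝓡 2) ∞ S]

/-! ### Curves on the surface -/

/-- The velocity of a curve `α : I → S`. -/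
def velocity (α : ℝ → S) (I : Set ℝ) (t : ℝ) : TangentSpace (𝓡 2) (α t) :=
  mfderivWithin 𝓘(ℝ, ℝ) (𝓡 2) α I t (1 : ℝ)

omit [IsManifold (𝓡 2) ∞ S] in
lemma hasDerivWithinAt_comp_curve {V : Type*} [NormedAddCommGroup V] [NormedSpace ℝ V]
    {f : S → V} {α : ℝ → S} {I : Set ℝ} {t : ℝ}
    (hf : MDifferentiableAt (𝓡 2) 𝓘(ℝ, V) f (α t))
    (hα : MDifferentiableWithinAt 𝓘(ℝ, ℝ) (𝓡 2) α I t) :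
    HasDerivWithinAt (fun s => f (α s)) (mfderiv (𝓡 2) 𝓘(ℝ, V) f (α t) (velocity α I t)) I t := by
  have h := hf.hasMFDerivAt.comp_hasMFDerivWithinAt t hα.hasMFDerivWithinAt
  obtain ⟨L, hL, hL1⟩ : ∃ L : ℝ →L[ℝ] V, HasFDerivWithinAt (fun s => f (α s)) L I t ∧
      L 1 = mfderiv (𝓡 2) 𝓘(ℝ, V) f (α t) (velocity α I t) :=
    ⟨_, hasMFDerivWithinAt_iff_hasFDerivWithinAt.1 h, rfl⟩
  exact hL.hasDerivWithinAt.congr_deriv hL1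

/-- The derivative of a smooth map in the direction `J α'` is smooth along a smooth curve `α`. -/
lemma contDiffOn_mfderiv_rotation_velocity {V : Type} [NormedAddCommGroup V] [NormedSpace ℝ V]
    {h : SurfaceMetric S} (J : RightAngleRotation h) {f : S → V}
    (hf : ContMDiff (𝓡 2) 𝓘(ℝ, V) ∞ f) {α : ℝ → S} {I : Set ℝ} (hI : UniqueDiffOn ℝ I)
    (hα : ContMDiffOn 𝓘(ℝ, ℝ) (𝓡 2) ∞ α I) :
    ContDiffOn ℝ ∞ (fun t => differential f (α t) (J.J (α t) (velocity α I t))) I := by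
  have h1 : ContMDiffOn 𝓘(ℝ, ℝ) (𝓡 2).tangent ∞
      (fun t => (⟨α t, velocity α I t⟩ : TangentBundle (𝓡 2) S)) I := by
    have h2 := hα.contMDiffOn_tangentMapWithin (m := ∞) (by simp) hI.uniqueMDiffOn
    have h3 : ContMDiff 𝓘(ℝ, ℝ) 𝓘(ℝ, ℝ).tangent ∞
        (fun t : ℝ => (⟨t, (1 : ℝ)⟩ : TangentBundle 𝓘(ℝ, ℝ) ℝ)) := by
      intro t
      exact contMDiffWithinAt_univ.1 (contMDiffWithinAt_vectorSpace_iff_contDiffWithinAt.2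
        (contDiffWithinAt_const (c := (1 : ℝ))))
    exact h2.comp h3.contMDiffOn (fun t ht => ht)
  have h2 : ContMDiffOn 𝓘(ℝ, ℝ) (𝓡 2).tangent ∞
      (fun t => (⟨α t, J.J (α t) (velocity α I t)⟩ : TangentBundle (𝓡 2) S)) I :=
    ContMDiffOn.clm_bundle_apply (J.smooth.comp_contMDiffOn hα) h1
  have h3 := (hf.contMDiff_tangentMap (m := ∞) (by simp)).comp_contMDiffOn h2
  exact ((contMDiff_snd_tangentBundle_modelSpace V 𝓘(ℝ, V)).comp_contMDiffOn h3).contDiffOn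

/-! ### Intrinsic acceleration -/

variable {M : FiberedModel (Fin 4 → ℝ)} {h : SurfaceMetric S}

lemma mdifferentiableAt_extChartAt_symm {p : S} {y : EuclideanSpace ℝ (Fin 2)}
    (hy : y ∈ (extChartAt (𝓡 2) p).target) :
    MDifferentiableAt 𝓘(ℝ, EuclideanSpace ℝ (Fin 2)) (𝓡 2) (extChartAt (𝓡 2) p).symm y :=
  haveI : IsManifold (𝓡 2) 1 S := IsManifold.of_le (n := ∞) (by simp)
  (mdifferentiableOn_extChartAt_symm y hy).mdifferentiableAt
    ((isOpen_extChartAt_target p).mem_nhds hy)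

/-- The metric of the surface on the parameter domain of the preferred chart at `p`. -/
def chartMetric (h : SurfaceMetric S) (p : S) (y u v : EuclideanSpace ℝ (Fin 2)) : ℝ :=
  h.inner ((extChartAt (𝓡 2) p).symm y)
    (mfderiv 𝓘(ℝ, EuclideanSpace ℝ (Fin 2)) (𝓡 2) (extChartAt (𝓡 2) p).symm y u)
    (mfderiv 𝓘(ℝ, EuclideanSpace ℝ (Fin 2)) (𝓡 2) (extChartAt (𝓡 2) p).symm y v)

namespace IsometricImmersion

lemma mdifferentiableAt (F : IsometricImmersion M h) (p : S) :
    MDifferentiableAt (𝓡 2) 𝓘(ℝ, Fin 4 → ℝ) F.φ p :=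
  (F.smooth p).mdifferentiableAt (by simp)

/-- The differential of an immersion in a chart of the surface. -/
lemma fderiv_comp_extChartAt_symm (F : IsometricImmersion M h) {p : S}
    {y : EuclideanSpace ℝ (Fin 2)} (hy : y ∈ (extChartAt (𝓡 2) p).target)
    (u : EuclideanSpace ℝ (Fin 2)) :
    fderiv ℝ (fun z => F.φ ((extChartAt (𝓡 2) p).symm z)) y u
      = differential F.φ ((extChartAt (𝓡 2) p).symm y)
          (mfderiv 𝓘(ℝ, EuclideanSpace ℝ (Fin 2)) (𝓡 2) (extChartAt (𝓡 2) p).symm y u) := by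
  have h1 := (F.mdifferentiableAt ((extChartAt (𝓡 2) p).symm y)).hasMFDerivAt.comp y
    (mdifferentiableAt_extChartAt_symm hy).hasMFDerivAt
  obtain ⟨L, hL, hL1⟩ : ∃ L : EuclideanSpace ℝ (Fin 2) →L[ℝ] (Fin 4 → ℝ),
      HasFDerivAt (fun z => F.φ ((extChartAt (𝓡 2) p).symm z)) L y ∧
      L u = differential F.φ ((extChartAt (𝓡 2) p).symm y)
          (mfderiv 𝓘(ℝ, EuclideanSpace ℝ (Fin 2)) (𝓡 2) (extChartAt (𝓡 2) p).symm y u) :=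
    ⟨_, hasMFDerivAt_iff_hasFDerivAt.1 h1, rfl⟩
  rw [hL.fderiv, hL1]

lemma fderiv_comp_extChartAt_symm_self (F : IsometricImmersion M h) (p : S)
    (u : TangentSpace (𝓡 2) p) :
    fderiv ℝ (fun z => F.φ ((extChartAt (𝓡 2) p).symm z)) (extChartAt (𝓡 2) p p) u
      = differential F.φ p u := by
  rw [differential, (F.mdifferentiableAt p).mfderiv, ModelWithCorners.range_eq_univ,
    fderivWithin_univ]
  rfl

lemma contDiffAt_comp_extChartAt_symm (F : IsometricImmersion M h) (p : S) :
    ContDiffAt ℝ ∞ (fun z => F.φ ((extChartAt (𝓡 2) p).symm z)) (extChartAt (𝓡 2) p p) := by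
  have h1 := F.smooth.comp_contMDiffOn (contMDiffOn_extChartAt_symm (I := 𝓡 2) (n := ∞) p)
  exact (contMDiffOn_iff_contDiffOn.1 h1).contDiffAt
    ((isOpen_extChartAt_target p).mem_nhds (mem_extChartAt_target p))

lemma differential_mem_tangent (hM : M.IsRegular) (F : IsometricImmersion M h) (p : S)
    (v : TangentSpace (𝓡 2) p) : differential F.φ p v ∈ M.tangent (F.φ p) := by
  let v' : EuclideanSpace ℝ (Fin 2) := v
  have h1 : HasDerivAt (fun s : ℝ => extChartAt (𝓡 2) p p + s • v') v' 0 := by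
    simpa using ((hasDerivAt_id (0 : ℝ)).smul_const v').const_add (extChartAt (𝓡 2) p p)
  have h2 := HasFDerivAt.comp_hasDerivAt (f := fun s : ℝ => extChartAt (𝓡 2) p p + s • v') 0
    (by rw [zero_smul, add_zero]; exact ((F.contDiffAt_comp_extChartAt_symm p).differentiableAt
      (by simp)).hasFDerivAt) h1
  rw [fderiv_comp_extChartAt_symm_self] at h2
  simpa using hM.mem_tangent _ _ h2 fun s => F.mem _

/-- The metric induced on the parameter domain of a chart is the metric of the surface. -/
lemma metric_fderiv_comp_extChartAt_symm (F : IsometricImmersion M h) {p : S}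
    {y : EuclideanSpace ℝ (Fin 2)} (hy : y ∈ (extChartAt (𝓡 2) p).target)
    (u v : EuclideanSpace ℝ (Fin 2)) :
    M.metric (F.φ ((extChartAt (𝓡 2) p).symm y))
        (fderiv ℝ (fun z => F.φ ((extChartAt (𝓡 2) p).symm z)) y u)
        (fderiv ℝ (fun z => F.φ ((extChartAt (𝓡 2) p).symm z)) y v)
      = chartMetric h p y u v := by
  rw [F.fderiv_comp_extChartAt_symm hy, F.fderiv_comp_extChartAt_symm hy, F.isometric, chartMetric]

/-- The tangential acceleration of a curve on the surface, computed in a chart with coordinate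
representation `a` of the curve. The right-hand side depends only on the metric of the surface. -/
lemma acceleration_eq_chartMetric (hM : M.IsRegular) (F : IsometricImmersion M h) {α : ℝ → S}
    {I : Set ℝ} (hI : UniqueDiffOn ℝ I) (hα : ContMDiffOn 𝓘(ℝ, ℝ) (𝓡 2) ∞ α I) {t : ℝ}
    (ht : t ∈ I) (v : EuclideanSpace ℝ (Fin 2)) :
    let q := extChartAt (𝓡 2) (α t) (α t)
    let a := fun s => extChartAt (𝓡 2) (α t) (α s)
    let G := chartMetric h (α t)
    M.acceleration (fun s => F.φ (α s)) I t (differential F.φ (α t) v)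
      = deriv (fun s : ℝ => G (q + s • derivWithin a I t) (derivWithin a I t) v) 0
        - deriv (fun s : ℝ => G (q + s • v) (derivWithin a I t) (derivWithin a I t)) 0 / 2
        + G q (derivWithin (derivWithin a I) I t) v := by
  intro q a G
  let f := fun z => F.φ ((extChartAt (𝓡 2) (α t)).symm z)
  have hqt : q ∈ (extChartAt (𝓡 2) (α t)).target := mem_extChartAt_target (α t)
  have hline : ∀ w : EuclideanSpace ℝ (Fin 2), ∀ᶠ s : ℝ in nhds 0,
      q + s • w ∈ (extChartAt (𝓡 2) (α t)).target := fun w => by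
    have hc : ContinuousAt (fun s : ℝ => q + s • w) 0 := by fun_prop
    exact hc (by simpa using (isOpen_extChartAt_target (I := 𝓡 2) (α t)).mem_nhds hqt)
  have hG : ∀ w u v : EuclideanSpace ℝ (Fin 2),
      deriv (fun s : ℝ => M.metric (f (q + s • w)) (fderiv ℝ f (q + s • w) u)
        (fderiv ℝ f (q + s • w) v)) 0 = deriv (fun s : ℝ => G (q + s • w) u v) 0 :=
    fun w u v => Filter.EventuallyEq.deriv_eq ((hline w).mono fun s hs =>
      F.metric_fderiv_comp_extChartAt_symm hs u v)
  have h2 : (2 : WithTop ℕ∞) ≤ ∞ := WithTop.coe_le_coe.2 (le_top (a := (2 : ℕ∞)))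
  have h11 : (1 : WithTop ℕ∞) + 1 ≤ ∞ := one_add_one_eq_two.trans_le h2
  have hf : ContDiffAt ℝ ∞ f q := F.contDiffAt_comp_extChartAt_symm (α t)
  have hsource : ∀ᶠ s in nhdsWithin t I, α s ∈ (extChartAt (𝓡 2) (α t)).source :=
    (hα t ht).continuousWithinAt (extChartAt_source_mem_nhds (I := 𝓡 2) (α t))
  have ha : ContDiffWithinAt ℝ ∞ a I t := by
    have h1 : ContMDiffAt (𝓡 2) 𝓘(ℝ, EuclideanSpace ℝ (Fin 2)) ∞ (extChartAt (𝓡 2) (α t)) (α t) :=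
      contMDiffAt_extChartAt
    exact contMDiffWithinAt_iff_contDiffWithinAt.1 (h1.comp_contMDiffWithinAt t (hα t ht))
  have hat : a t = q := rfl
  have ha2 : ∀ᶠ s in nhdsWithin t I, DifferentiableWithinAt ℝ a I s := by
    have := (ha.of_le (m := 1) (by simp)).eventually (by simp)
    rw [insert_eq_of_mem ht] at this
    exact this.mono fun s hs => hs.differentiableWithinAt one_ne_zero
  have hf2 : ∀ᶠ s in nhdsWithin t I, DifferentiableAt ℝ f (a s) := by
    have := (hf.of_le (m := 1) (by simp)).eventually (by simp)
    rw [← hat] at this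
    exact (ha.continuousWithinAt.eventually this).mono fun s hs =>
      hs.differentiableAt one_ne_zero
  have hfa : (fun s => F.φ (α s)) =ᶠ[nhdsWithin t I] fun s => f (a s) :=
    hsource.mono fun s hs => by simp only [f, a, (extChartAt (𝓡 2) (α t)).left_inv hs]
  have hd : derivWithin (fun s => F.φ (α s)) I
      =ᶠ[nhdsWithin t I] fun s => fderiv ℝ f (a s) (derivWithin a I s) := by
    filter_upwards [eventually_eventually_nhdsWithin.2 hfa, ha2, hf2, self_mem_nhdsWithin]
      with s h1 h2 h3 hs
    have h1' : (fun s => F.φ (α s)) =ᶠ[nhdsWithin s I] fun s => f (a s) := h1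
    rw [h1'.derivWithin_eq (h1'.self_of_nhdsWithin hs)]
    exact (h3.hasFDerivAt.comp_hasDerivWithinAt s h2.hasDerivWithinAt).derivWithin (hI s hs)
  have hd2 : derivWithin (fun s => derivWithin (fun s => F.φ (α s)) I s) I t
      = fderiv ℝ (fderiv ℝ f) q (derivWithin a I t) (derivWithin a I t)
        + fderiv ℝ f q (derivWithin (derivWithin a I) I t) := by
    have hd' : (fun s => derivWithin (fun s => F.φ (α s)) I s)
      =ᶠ[nhdsWithin t I] fun s => fderiv ℝ f (a s) (derivWithin a I s) := hd
    rw [hd'.derivWithin_eq (hd'.self_of_nhdsWithin ht)]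
    have h1 : HasFDerivAt (fderiv ℝ f) (fderiv ℝ (fderiv ℝ f) q) (a t) :=
      ((hf.fderiv_right h11).differentiableAt (by simp)).hasFDerivAt
    have h2 : HasDerivWithinAt a (derivWithin a I t) I t :=
      (ha.differentiableWithinAt (by simp)).hasDerivWithinAt
    have h3 : HasDerivWithinAt (derivWithin a I) (derivWithin (derivWithin a I) I t) I t :=
      ((ha.derivWithin hI h11 ht).differentiableWithinAt
        one_ne_zero).hasDerivWithinAt
    exact ((h1.comp_hasDerivWithinAt t h2).clm_apply h3).derivWithin (hI t ht)
  have hq : f q = F.φ (α t) := by simp only [f, q, extChartAt_to_inv]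
  have hv : differential F.φ (α t) v = fderiv ℝ f q v :=
    (F.fderiv_comp_extChartAt_symm_self (α t) v).symm
  have hK := hM.metric_second_derivative_add_christoffel (hf.of_le h2)
    (by rw [hq]; exact F.mem _) (derivWithin a I t) v
  rw [MetricModel.acceleration, MetricModel.covDeriv, hd2, hd.self_of_nhdsWithin ht, hv, ← hq,
    hM.add_left]
  have hGq : G q (derivWithin (derivWithin a I) I t) v
      = M.metric (f q) (fderiv ℝ f q (derivWithin (derivWithin a I) I t)) (fderiv ℝ f q v) :=
    (F.metric_fderiv_comp_extChartAt_symm hqt _ v).symm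
  rw [hGq, ← hG, ← hG, ← hK]
  simp only [hat]
  ring

/-- The tangential part of the acceleration of a curve in a Riemannian surface is intrinsic: it is
the same for all isometric immersions of the surface. -/
lemma acceleration_eq_acceleration (hM : M.IsRegular) (F : IsometricImmersion M h)
    {M' : FiberedModel (Fin 4 → ℝ)} (hM' : M'.IsRegular) (F' : IsometricImmersion M' h)
    {α : ℝ → S} {I : Set ℝ} (hI : UniqueDiffOn ℝ I) (hα : ContMDiffOn 𝓘(ℝ, ℝ) (𝓡 2) ∞ α I)
    {t : ℝ} (ht : t ∈ I) (v : TangentSpace (𝓡 2) (α t)) :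
    M.acceleration (fun s => F.φ (α s)) I t (differential F.φ (α t) v)
      = M'.acceleration (fun s => F'.φ (α s)) I t (differential F'.φ (α t) v) := by
  exact (F.acceleration_eq_chartMetric hM hI hα ht v).trans
    (F'.acceleration_eq_chartMetric hM' hI hα ht v).symm

end IsometricImmersion

/-! ### Immersions along a curve -/

lemma RightAngleRotation.inner_self_J (J : RightAngleRotation h) (p : S)
    (u : TangentSpace (𝓡 2) p) : h.inner p u (J.J p u) = 0 := by
  have h1 := J.isometry p u (J.J p u)
  rw [J.sq, map_neg, h.symm p (J.J p u) u] at h1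
  linarith

namespace IsometricImmersion

lemma hasDerivWithinAt_comp (F : IsometricImmersion M h) {α : ℝ → S} {I : Set ℝ}
    (hα : ContMDiffOn 𝓘(ℝ, ℝ) (𝓡 2) ∞ α I) {t : ℝ} (ht : t ∈ I) :
    HasDerivWithinAt (fun s => F.φ (α s)) (differential F.φ (α t) (velocity α I t)) I t :=
  hasDerivWithinAt_comp_curve (F.mdifferentiableAt _) ((hα t ht).mdifferentiableWithinAt (by simp))

lemma hasDerivWithinAt_normal_comp (F : IsometricImmersion M h) {α : ℝ → S} {I : Set ℝ}
    (hα : ContMDiffOn 𝓘(ℝ, ℝ) (𝓡 2) ∞ α I) {t : ℝ} (ht : t ∈ I) :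
    HasDerivWithinAt (fun s => F.N (α s)) (differential F.N (α t) (velocity α I t)) I t :=
  hasDerivWithinAt_comp_curve ((F.smooth_normal _).mdifferentiableAt (by simp))
    ((hα t ht).mdifferentiableWithinAt (by simp))

lemma contDiffOn_comp (F : IsometricImmersion M h) {α : ℝ → S} {I : Set ℝ}
    (hα : ContMDiffOn 𝓘(ℝ, ℝ) (𝓡 2) ∞ α I) : ContDiffOn ℝ ∞ (fun s => F.φ (α s)) I :=
  (F.smooth.comp_contMDiffOn hα).contDiffOn

lemma differentiableWithinAt_derivWithin_comp (F : IsometricImmersion M h) {α : ℝ → S}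
    {I : Set ℝ} (hI : UniqueDiffOn ℝ I) (hα : ContMDiffOn 𝓘(ℝ, ℝ) (𝓡 2) ∞ α I) {t : ℝ}
    (ht : t ∈ I) : DifferentiableWithinAt ℝ (derivWithin (fun s => F.φ (α s)) I) I t :=
  ((F.contDiffOn_comp hα).derivWithin hI (m := 1)
    (one_add_one_eq_two.trans_le (WithTop.coe_le_coe.2 (le_top (a := (2 : ℕ∞)))))
    ).differentiableOn one_ne_zero t ht

/-- The normal curvature of a curve is the second fundamental form of its velocity. -/
lemma inner_shapeOperator_velocity (hM : M.IsRegular) (F : IsometricImmersion M h)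
    {A : ∀ p : S, TangentSpace (𝓡 2) p →ₗ[ℝ] TangentSpace (𝓡 2) p} (hA : F.IsShapeOperator A)
    {α : ℝ → S} {I : Set ℝ} (hI : UniqueDiffOn ℝ I) (hα : ContMDiffOn 𝓘(ℝ, ℝ) (𝓡 2) ∞ α I)
    {t : ℝ} (ht : t ∈ I) :
    h.inner (α t) (A (α t) (velocity α I t)) (velocity α I t)
      = M.acceleration (fun s => F.φ (α s)) I t (F.N (α t)) := by
  have hd : ∀ s ∈ I, derivWithin (fun s => F.φ (α s)) I s
      = differential F.φ (α s) (velocity α I s) :=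
    fun s hs => (F.hasDerivWithinAt_comp hα hs).derivWithin (hI s hs)
  have h1 := hM.covDeriv_add_acceleration (hI t ht) ht
    (F.hasDerivWithinAt_comp hα ht).differentiableWithinAt
    (F.differentiableWithinAt_derivWithin_comp hI hα ht) (F.hasDerivWithinAt_normal_comp hα ht)
    (F.mem _) (fun s hs => by rw [hd s hs]; exact F.normal_orthogonal _ _)
  rw [hd t ht] at h1
  rw [hA]
  linarith

variable {ε H : ℝ} {J : RightAngleRotation h}

lemma IsSister.exists_tangentPart {F : IsometricImmersion M h} {M' : FiberedModel (Fin 4 → ℝ)}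
    {F' : IsometricImmersion M' h} (hs : IsSister J (Real.pi / 2) 0 H F F') :
    ∃ T : ∀ p : S, TangentSpace (𝓡 2) p, F.IsTangentPart T ∧
      F'.IsTangentPart fun p => J.J p (T p) := by
  obtain ⟨-, -, -, ⟨T, T', hT, hT', hTT⟩, -⟩ := hs
  refine ⟨T, hT, fun p => ?_⟩
  rw [← hT' p, hTT p]
  simp [RightAngleRotation.rotation]

lemma IsSister.exists_shapeOperator {F : IsometricImmersion M h} {M' : FiberedModel (Fin 4 → ℝ)}
    {F' : IsometricImmersion M' h} (hs : IsSister J (Real.pi / 2) 0 H F F') :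
    ∃ A A', F.IsShapeOperator A ∧ F'.IsShapeOperator A' ∧
      ∀ (p : S) (u : TangentSpace (𝓡 2) p), A' p u = J.J p (A p u) + H • u := by
  obtain ⟨-, -, -, -, A, A', hA, hA', hAA⟩ := hs
  refine ⟨A, A', hA, hA', fun p u => ?_⟩
  rw [hAA p u]
  simp [RightAngleRotation.rotation]

/-! ### Vertical geodesics -/

/-- Where `φ` maps the curve to a vertical geodesic, `ν = 0` and the velocity is a multiple of `T`.
So the velocity is orthogonal to `JT`, the tangent part of the vertical field of `φ'`: the height of
`φ'` has derivative zero. -/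
lemma IsSister.slice_of_vertical (hM : M.IsRegular) (hε : ε = -1 ∨ ε = 1)
    {F : IsometricImmersion M h} {F' : IsometricImmersion (productSpace ε) h}
    (hs : IsSister J (Real.pi / 2) 0 H F F') {a b : ℝ} (hab : a < b) {α : ℝ → S}
    (hα : ContMDiffOn 𝓘(ℝ, ℝ) (𝓡 2) ∞ α (Icc a b))
    (hv : M.IsVerticalGeodesicOn (fun t => F.φ (α t)) (Icc a b)) :
    ∃ z₀ : ℝ, ∀ t ∈ Icc a b, F'.φ (α t) ∈ slice ε z₀ ∧
      F'.MeetsOrthogonally (α t) (sliceTangent ε (F'.φ (α t))) := by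
  have hI : UniqueDiffOn ℝ (Icc a b) := uniqueDiffOn_Icc hab
  have hε0 : ε ≠ 0 := by rcases hε with rfl | rfl <;> norm_num
  have hM' := productSpace_isRegular hε0
  obtain ⟨T, hT, hT'⟩ := hs.exists_tangentPart
  have hangle : ∀ t ∈ Icc a b, F.angle (α t) = 0 ∧
      h.inner (α t) (velocity α (Icc a b) t) (J.J (α t) (T (α t))) = 0 := by
    intro t ht
    obtain ⟨r, hr⟩ := hv.2 t ht
    have hne := hv.1.ne_zero t ht
    rw [(F.hasDerivWithinAt_comp hα ht).derivWithin (hI t ht)] at hr hne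
    have hr0 : r ≠ 0 := by
      rintro rfl
      rw [hr, zero_smul] at hne
      exact hne rfl
    have hν : F.angle (α t) = 0 := by
      have h1 := F.normal_orthogonal (α t) (velocity α (Icc a b) t)
      rw [hr, hM.smul_right] at h1
      exact (mul_eq_zero.1 h1).resolve_left hr0
    refine ⟨hν, ?_⟩
    -- The immersion identifies `r T` with the velocity, so these vectors have the same products.
    have hinner : ∀ w, h.inner (α t) (velocity α (Icc a b) t) w = r * h.inner (α t) (T (α t)) w := by
      intro w
      rw [← F.isometric, ← F.isometric, hT, hr, hν, zero_smul, sub_zero, hM.smul_left]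
    rw [hinner, J.inner_self_J, mul_zero]
  have hν' : ∀ t ∈ Icc a b, F'.N (α t) 3 = 0 := by
    intro t ht
    have h1 : F'.angle (α t) = 0 := by rw [hs.2.2.1, (hangle t ht).1]
    rwa [angle, productSpace_metric_xi] at h1
  have hd : ∀ t ∈ Icc a b, HasDerivWithinAt (fun s => F'.φ (α s) 3) 0 (Icc a b) t := by
    intro t ht
    have h1 := hasDerivWithinAt_pi.1 (F'.hasDerivWithinAt_comp hα ht) 3
    refine h1.congr_deriv ?_
    have h2 := (hangle t ht).2
    rw [← F'.isometric, hT', hs.2.2.1, (hangle t ht).1, zero_smul, sub_zero] at h2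
    rwa [productSpace_metric_xi] at h2
  refine ⟨F'.φ (α a) 3, fun t ht => ⟨⟨F'.mem _, ?_⟩, ?_⟩⟩
  · exact constant_of_derivWithin_zero (fun s hs => (hd s hs).differentiableWithinAt)
      (fun s hs => (hd s (Ico_subset_Icc_self hs)).derivWithin (hI s (Ico_subset_Icc_self hs))) t ht
  · exact fun n _ hn => hn _ ⟨F'.normal_mem _, hν' t ht⟩

/-! ### Horizontal geodesics -/

lemma productSpace_metric_eq_ambientForm (hε : ε = -1 ∨ ε = 1) (x u v : Fin 4 → ℝ) :
    (productSpace ε).metric x u v = ambientForm ε (base u) (base v) + u 3 * v 3 := by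
  rw [productSpace_metric, sign_eq_self hε]
  rfl

/-- The metric of `M²(ε) × ℝ` has constant coefficients, so ordinary derivatives of two fields with
constant product satisfy the product rule. -/
lemma productSpace_metric_derivative {u v : ℝ → Fin 4 → ℝ}
    {u' v' : Fin 4 → ℝ} {I : Set ℝ} {t : ℝ} (hI : UniqueDiffWithinAt ℝ I t) (ht : t ∈ I)
    (hu : HasDerivWithinAt u u' I t) (hv : HasDerivWithinAt v v' I t) {c : ℝ}
    (x : Fin 4 → ℝ) (h0 : ∀ s ∈ I, (productSpace ε).metric x (u s) (v s) = c) :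
    (productSpace ε).metric x u' (v t) + (productSpace ε).metric x (u t) v' = 0 := by
  have h1 := hasDerivWithinAt_pi.1 hu
  have h2 := hasDerivWithinAt_pi.1 hv
  have h3 : HasDerivWithinAt (fun s => (productSpace ε).metric x (u s) (v s)) 0 I t :=
    (hasDerivWithinAt_const t I c).congr h0 (h0 t ht)
  have h4 := hI.eq_deriv _ ((((h1 0).mul (h2 0)).add ((h1 1).mul (h2 1))).add
    (((h1 2).mul (h2 2)).const_mul ε.sign) |>.add ((h1 3).mul (h2 3))) h3
  simp only [productSpace_metric]
  linear_combination h4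

/-- The position vector of the base point and an orthogonal frame of the tangent space of
`M²(ε) × ℝ` form an orthogonal frame of the ambient space. -/
lemma eq_zero_of_orthogonal_position (hε : ε = -1 ∨ ε = 1) {x N v n w : Fin 4 → ℝ}
    (hx : x ∈ (productSpace ε).carrier) (hN : N ∈ (productSpace ε).tangent x)
    (hv : v ∈ (productSpace ε).tangent x) (hn : n ∈ (productSpace ε).tangent x)
    (hNN : (productSpace ε).metric x N N ≠ 0) (hvv : (productSpace ε).metric x v v ≠ 0)
    (hnn : (productSpace ε).metric x n n ≠ 0) (hNv : (productSpace ε).metric x N v = 0)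
    (hNn : (productSpace ε).metric x N n = 0) (hvn : (productSpace ε).metric x v n = 0)
    (hwx : w ∈ (productSpace ε).tangent x) (hwN : (productSpace ε).metric x N w = 0)
    (hwv : (productSpace ε).metric x v w = 0) (hwn : (productSpace ε).metric x n w = 0) :
    w = 0 := by
  have hε0 : ε ≠ 0 := by rcases hε with rfl | rfl <;> norm_num
  have hxx := (mem_productSpace_carrier.1 hx).1
  rw [mem_productSpace_tangent] at hN hv hn hwx
  simp only [productSpace_metric] at *
  rw [sign_eq_self hε] at *
  have hx0 : x 0 * x 0 + x 1 * x 1 + ε * x 2 * x 2 ≠ 0 := by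
    intro h0
    have : ε * 0 = 1 := by rw [← h0]; linear_combination hxx
    simp at this
  refine eq_zero_of_orthogonal_frame ![1, 1, ε, 1] ![![x 0, x 1, x 2, 0], N, v, n] ?_ ?_ _ ?_
  · intro i j hij
    fin_cases i <;> fin_cases j <;> simp [Fin.sum_univ_four] at hij ⊢ <;> linarith
  · intro i
    fin_cases i <;> simp [Fin.sum_univ_four]
    · exact hx0
    · exact fun h0 => hNN (by linear_combination h0)
    · exact fun h0 => hvv (by linear_combination h0)
    · exact fun h0 => hnn (by linear_combination h0)
  · intro i
    fin_cases i <;> simp [Fin.sum_univ_four] <;> linarith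

/-- Along a curve whose image under `φ` is a horizontal geodesic, the unit conormal field
`φ'_* (J α') / |α'|` of the sister immersion is horizontal, and it is constant in the ambient
vector space. -/
lemma IsSister.exists_constant_conormal (hM : M.IsRegular) (hε : ε = -1 ∨ ε = 1)
    {F : IsometricImmersion M h} {F' : IsometricImmersion (productSpace ε) h}
    (hs : IsSister J (Real.pi / 2) 0 H F F') {a b : ℝ} (hab : a < b) {α : ℝ → S}
    (hα : ContMDiffOn 𝓘(ℝ, ℝ) (𝓡 2) ∞ α (Icc a b))
    (hh : M.IsHorizontalGeodesicOn (fun t => F.φ (α t)) (Icc a b)) :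
    ∃ B : Fin 4 → ℝ, B 3 = 0 ∧ ∀ t ∈ Icc a b, B ∈ (productSpace ε).tangent (F'.φ (α t)) ∧
      (productSpace ε).metric (F'.φ (α t)) B B = 1 ∧
      (productSpace ε).metric (F'.φ (α t)) (F'.N (α t)) B = 0 := by
  have hI : UniqueDiffOn ℝ (Icc a b) := uniqueDiffOn_Icc hab
  have hε0 : ε ≠ 0 := by rcases hε with rfl | rfl <;> norm_num
  have hM' := productSpace_isRegular hε0
  obtain ⟨T, hT, hT'⟩ := hs.exists_tangentPart
  obtain ⟨A, A', hA, hA', hAA⟩ := hs.exists_shapeOperator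
  set I := Icc a b
  set u : ∀ t, TangentSpace (𝓡 2) (α t) := velocity α I with hu
  have hd : ∀ t ∈ I, derivWithin (fun s => F.φ (α s)) I t = differential F.φ (α t) (u t) :=
    fun t ht => (F.hasDerivWithinAt_comp hα ht).derivWithin (hI t ht)
  have hd' : ∀ t ∈ I, derivWithin (fun s => F'.φ (α s)) I t = differential F'.φ (α t) (u t) :=
    fun t ht => (F'.hasDerivWithinAt_comp hα ht).derivWithin (hI t ht)
  have hpos : ∀ t ∈ I, 0 < h.inner (α t) (u t) (u t) := fun t ht => by
    refine h.pos _ _ fun h0 => hh.1.ne_zero t ht ?_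
    rw [hd t ht, h0]
    exact map_zero _
  let X : ℝ → Fin 4 → ℝ := fun t => differential F'.φ (α t) (J.J (α t) (u t))
  have hX : ContDiffOn ℝ ∞ X I := contDiffOn_mfderiv_rotation_velocity J F'.smooth hI hα
  have hXX : ∀ x t, (productSpace ε).metric x (X t) (X t) = h.inner (α t) (u t) (u t) :=
    fun x t => (F'.isometric (α t) _ _).trans (J.isometry _ _ _)
  have hX3 : ∀ t ∈ I, X t 3 = 0 := fun t ht => by
    have h1 := hh.2 t ht
    have h2 : M.xi (F.φ (α t)) = differential F.φ (α t) (T (α t)) + F.angle (α t) • F.N (α t) := by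
      rw [hT]; abel
    rw [hd t ht, h2, hM.add_right, hM.smul_right, F.isometric, hM.symm, F.normal_orthogonal,
      mul_zero, add_zero, ← J.isometry, ← F'.isometric, hT', hM'.sub_right, hM'.smul_right,
      hM'.symm _ _ (F'.N (α t)), F'.normal_orthogonal, mul_zero, sub_zero] at h1
    rwa [productSpace_metric_xi] at h1
  let r : ℝ → ℝ := fun t => (√((productSpace ε).metric 0 (X t) (X t)))⁻¹
  have hr2 : ∀ t ∈ I, r t * r t * h.inner (α t) (u t) (u t) = 1 := fun t ht => by
    have h1 := Real.mul_self_sqrt (hpos t ht).le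
    have h2 := (Real.sqrt_pos.2 (hpos t ht)).ne'
    simp only [r, hXX]
    rw [← mul_inv, h1, inv_mul_cancel₀ (hpos t ht).ne']
  have hr : DifferentiableOn ℝ r I := by
    have h1 : DifferentiableOn ℝ X I := hX.differentiableOn (by simp)
    have h2 := fun i t ht => differentiableWithinAt_pi.1 (h1 t ht) i
    intro t ht
    refine DifferentiableWithinAt.inv (DifferentiableWithinAt.sqrt ?_ ?_) ?_
    · simp only [productSpace_metric]
      have h20 := h2 0 t ht
      have h21 := h2 1 t ht
      have h22 := h2 2 t ht
      have h23 := h2 3 t ht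
      fun_prop
    · rw [hXX]; exact (hpos t ht).ne'
    · rw [hXX]; exact (Real.sqrt_pos.2 (hpos t ht)).ne'
  let B : ℝ → Fin 4 → ℝ := fun t => r t • X t
  have hB : DifferentiableOn ℝ B I := hr.smul (hX.differentiableOn (by simp))
  have hBt : ∀ t, B t ∈ (productSpace ε).tangent (F'.φ (α t)) := fun t =>
    Submodule.smul_mem _ _ (F'.differential_mem_tangent hM' _ _)
  have hB3 : ∀ t ∈ I, B t 3 = 0 := fun t ht => by simp [B, hX3 t ht]
  have hBB : ∀ x, ∀ t ∈ I, (productSpace ε).metric x (B t) (B t) = 1 := fun x t ht => by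
    simp only [B]
    rw [hM'.smul_left, hM'.smul_right, hXX, ← mul_assoc, hr2 t ht]
  have hNB : ∀ x, ∀ t ∈ I, (productSpace ε).metric x (F'.N (α t)) (B t) = 0 := fun x t ht => by
    simp only [B]
    rw [hM'.smul_right]
    exact mul_eq_zero_of_right _ (F'.normal_orthogonal (α t) _)
  have hvB : ∀ x, ∀ t ∈ I, (productSpace ε).metric x (derivWithin (fun s => F'.φ (α s)) I t) (B t)
      = 0 := fun x t ht => by
    simp only [B]
    rw [hM'.smul_right, hd' t ht]
    exact mul_eq_zero_of_right _ ((F'.isometric (α t) _ _).trans (J.inner_self_J _ _))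
  have hxB : ∀ x, ∀ t ∈ I, (productSpace ε).metric x (F'.φ (α t)) (B t) = 0 := fun x t ht => by
    have h1 := mem_productSpace_tangent.1 (hBt t)
    rw [productSpace_metric, hB3 t ht]
    linear_combination h1
  have hB' : ∀ t ∈ I, derivWithin B I t = 0 := by
    intro t ht
    have hBd := (hB t ht).hasDerivWithinAt
    have hB3' : derivWithin B I t 3 = 0 :=
      (hI t ht).eq_deriv _ (hasDerivWithinAt_pi.1 hBd 3)
        ((hasDerivWithinAt_const t I (0 : ℝ)).congr hB3 (hB3 t ht))
    have hx' := productSpace_metric_derivative (hI t ht) ht (F'.hasDerivWithinAt_comp hα ht) hBd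
      (F'.φ (α t)) (hxB _)
    have hN' := productSpace_metric_derivative (hI t ht) ht
      (F'.hasDerivWithinAt_normal_comp hα ht) hBd (F'.φ (α t)) (hNB _)
    have hv' := productSpace_metric_derivative (hI t ht) ht
      (F'.differentiableWithinAt_derivWithin_comp hI hα ht).hasDerivWithinAt hBd
      (F'.φ (α t)) (hvB _)
    have hn' := productSpace_metric_derivative (hI t ht) ht hBd hBd (F'.φ (α t)) (hBB _)
    -- The normal curvature of the geodesic vanishes, so the curve is a line of curvature of `F'`.
    have hshape : (productSpace ε).metric (F'.φ (α t)) (differential F'.N (α t) (u t)) (B t)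
        = 0 := by
      have h1 : h.inner (α t) (A (α t) (u t)) (u t) = 0 := by
        rw [F.inner_shapeOperator_velocity hM hA hI hα ht]
        refine hh.1.acceleration_eq t ht _ (F.normal_mem _) ?_
        rw [hd t ht, hM.symm]
        exact F.normal_orthogonal _ _
      have h2 := hA' (α t) (u t) (J.J (α t) (u t))
      rw [hAA, map_add, map_smul, add_apply, smul_apply, J.isometry, h1,
        J.inner_self_J, smul_zero, add_zero, productSpace_covDeriv] at h2
      simp only [B]
      rw [hM'.smul_right]
      exact mul_eq_zero_of_right _ (neg_eq_zero.1 h2.symm)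
    -- The geodesic curvature, which is intrinsic, vanishes too.
    have hgeo : (productSpace ε).metric (F'.φ (α t))
        (derivWithin (derivWithin (fun s => F'.φ (α s)) I) I t) (B t) = 0 := by
      have h1 := hh.1.acceleration_eq t ht (differential F.φ (α t) (J.J (α t) (u t)))
        (F.differential_mem_tangent hM _ _) (by
          rw [hd t ht, F.isometric]
          exact J.inner_self_J _ _)
      rw [F.acceleration_eq_acceleration hM hM' F' hI hα ht, MetricModel.acceleration,
        productSpace_covDeriv] at h1
      simp only [B]
      rw [hM'.smul_right]
      exact mul_eq_zero_of_right _ h1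
    refine eq_zero_of_orthogonal_position hε (F'.mem (α t)) (F'.normal_mem (α t))
      (F'.differential_mem_tangent hM' (α t) (u t)) (hBt t) ?_ ?_ ?_ (F'.normal_orthogonal _ _)
      (hNB _ t ht) ?_ ?_ ?_ ?_ ?_
    · rw [F'.normal_unit]; exact one_ne_zero
    · rw [F'.isometric]; exact (hpos t ht).ne'
    · rw [hBB _ t ht]; exact one_ne_zero
    · rw [← hd' t ht]; exact hvB _ t ht
    · rw [← hu, ← hd' t ht, hvB _ t ht, zero_add, productSpace_metric, hB3'] at hx'
      rw [mem_productSpace_tangent]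
      linear_combination hx'
    · rw [hshape, zero_add] at hN'; exact hN'
    · rw [hgeo, zero_add, hd' t ht] at hv'; exact hv'
    · rw [hM'.symm _ _ (B t)] at hn'; linarith
  have hconst : ∀ t ∈ I, B t = B a :=
    constant_of_derivWithin_zero hB fun t ht => hB' t (Ico_subset_Icc_self ht)
  refine ⟨B a, hB3 a (left_mem_Icc.2 hab.le), fun t ht => ?_⟩
  rw [← hconst t ht]
  exact ⟨hBt t, hBB _ t ht, hNB _ t ht⟩

/-- The curve `φ' ∘ α` lies over the plane section of `M²(ε)` orthogonal to its constant conormal;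
the normal of `φ'` is orthogonal to the conormal, hence tangent to the vertical plane. -/
lemma IsSister.verticalPlane_of_horizontal (hM : M.IsRegular) (hε : ε = -1 ∨ ε = 1)
    {F : IsometricImmersion M h} {F' : IsometricImmersion (productSpace ε) h}
    (hs : IsSister J (Real.pi / 2) 0 H F F') {a b : ℝ} (hab : a < b) {α : ℝ → S}
    (hα : ContMDiffOn 𝓘(ℝ, ℝ) (𝓡 2) ∞ α (Icc a b))
    (hh : M.IsHorizontalGeodesicOn (fun t => F.φ (α t)) (Icc a b)) :
    ∃ c : ℝ → Fin 3 → ℝ, IsCompleteGeodesic ε c ∧ ∀ t ∈ Icc a b,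
      F'.φ (α t) ∈ verticalPlane c ∧
        F'.MeetsOrthogonally (α t) (verticalPlaneTangent c (F'.φ (α t))) := by
  obtain ⟨B, hB3, hB⟩ := hs.exists_constant_conormal hM hε hab hα hh
  have htan : ∀ {x v : Fin 4 → ℝ}, v ∈ (productSpace ε).tangent x →
      ambientForm ε (base x) (base v) = 0 := fun {x v} hv => by
    have := mem_productSpace_tangent.1 hv
    rw [sign_eq_self hε] at this
    exact this
  have hbb : ambientForm ε (base B) (base B) = 1 := by
    have := (hB a (left_mem_Icc.2 hab.le)).2.1
    rwa [productSpace_metric_eq_ambientForm hε, hB3, mul_zero, add_zero] at this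
  obtain ⟨c, hc, hrange, hframe⟩ := exists_completeGeodesic hε (x₀ := base (F'.φ (α a)))
    (b := base B) (F'.mem _) hbb (htan (hB a (left_mem_Icc.2 hab.le)).1)
  refine ⟨c, hc, fun t ht => ?_⟩
  obtain ⟨s, hcs⟩ := hrange (base (F'.φ (α t))) (F'.mem _) (htan (hB t ht).1)
  refine ⟨⟨s, hcs⟩, fun n _ hn => hn _ ?_⟩
  -- The normal of the immersion is tangent to the vertical plane, being orthogonal to `B`.
  obtain ⟨hee, hxe, heb⟩ := hframe s
  have hsymm : ∀ x y, ambientForm ε x y = ambientForm ε y x := fun x y => by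
    simp only [ambientForm]; ring
  have h1 := eq_frame_expansion hε
    ((mem_surfaceModel_carrier hε).1 (F'.mem (α t) : base (F'.φ (α t)) ∈ _)).1 hee hbb
    (by rw [← hcs]; exact hxe) (htan (hB t ht).1) heb (base (F'.N (α t)))
  have h2 := (hB t ht).2.2
  rw [productSpace_metric_eq_ambientForm hε, hB3, mul_zero, add_zero] at h2
  rw [h2, hsymm _ (base (F'.φ (α t))), htan (F'.normal_mem (α t)), mul_zero, zero_smul, zero_smul,
    zero_add, add_zero] at h1
  exact ⟨s, _, hcs, h1⟩

end IsometricImmersion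

end Immersions

end SisterSurface

end

theorem mainTheorem7 {S : Type*} [TopologicalSpace S] [T2Space S] [SecondCountableTopology S]
    [ChartedSpace (EuclideanSpace ℝ (Fin 2)) S] [IsManifold (𝓡 2) ∞ S] [SimplyConnectedSpace S]
    (h : SisterSurface.SurfaceMetric S) (J : SisterSurface.RightAngleRotation h)
    (ε H : ℝ) (hε : ε = -1 ∨ ε = 1) (hH : 0 ≤ H)
    (F : SisterSurface.IsometricImmersion (SisterSurface.homogeneousSpace (4 * H ^ 2 + ε) H) h)
    (hF : F.IsMinimal)
    (F' : SisterSurface.IsometricImmersion (SisterSurface.productSpace ε) h)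
    (hF' : F'.IsCMC H)
    (hsister : SisterSurface.IsometricImmersion.IsSister J (Real.pi / 2) 0 H F F')
    (a b : ℝ) (hab : a < b) (α : ℝ → S) (hα : ContMDiffOn 𝓘(ℝ, ℝ) (𝓡 2) ∞ α (Icc a b)) :
    ((SisterSurface.homogeneousSpace (4 * H ^ 2 + ε) H).IsHorizontalGeodesicOn
        (fun t => F.φ (α t)) (Icc a b) →
      ∃ c : ℝ → Fin 3 → ℝ, SisterSurface.IsCompleteGeodesic ε c ∧
        ∀ t ∈ Icc a b, F'.φ (α t) ∈ SisterSurface.verticalPlane c ∧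
          F'.MeetsOrthogonally (α t) (SisterSurface.verticalPlaneTangent c (F'.φ (α t)))) ∧
    ((SisterSurface.homogeneousSpace (4 * H ^ 2 + ε) H).IsVerticalGeodesicOn
        (fun t => F.φ (α t)) (Icc a b) →
      ∃ z₀ : ℝ, ∀ t ∈ Icc a b, F'.φ (α t) ∈ SisterSurface.slice ε z₀ ∧
        F'.MeetsOrthogonally (α t) (SisterSurface.sliceTangent ε (F'.φ (α t)))) := by
  have hM := SisterSurface.homogeneousSpace_isRegular (4 * H ^ 2 + ε) H
  exact ⟨hsister.verticalPlane_of_horizontal hM hε hab hα,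
    hsister.slice_of_vertical hM hε hab hα⟩
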